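/- Let $M$ be a globally hyperbolic spacetime of dimension $m\ge 1$, i.e. a connected, Hausdorff, second-countable smooth $m$-manifold with a smooth Lorentzian metric of signature $(-,+,\dots,+)$, an orientation and a time-orientation, and admitting a Cauchy surface. Suppose that $i_\Sigma:\Sigma\to M$ is a compact, smooth, spacelike Cauchy surface, with the induced orientation and fundamental class $[\Sigma]\in H_{m-1}(\Sigma;\mathbb Z)$. Write $\mathbb T=\mathbb R/\mathbb Z$ and let $0\le k\le m$. Put $\mathrm{Top}^k_{\mathrm{tor}}(M)=H^k_{\mathrm{tor}}(M;\mathbb Z)\times H^{m-k}_{\mathrm{tor}}(M;\mathbb Z)$, where $H^p_{\mathrm{tor}}$ is the torsion subgroup of singular cohomology. For $t\in H^p_{\mathrm{tor}}(\Sigma;\mathbb Z)$ and $t'\in H^{m-p}_{\mathrm{tor}}(\Sigma;\mathbb Z)$ put $\langle t,t'\rangle=(u\smile t')[\Sigma]\in\mathbb T$, where $u\in H^{p-1}(\Sigma;\mathbb T)$ is any class whose Bockstein is $t$ (the pairing is $0$ for $p=0$), and equip $\mathrm{Top}^k_{\mathrm{tor}}(M)$ with the antisymmetric bi-homomorphism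 $$\sigma_{\mathrm{tor}}\big((t,\tilde t),(t',\tilde t')\big)=\langle i_\Sigma^*\tilde t,i_\Sigma^*t'\rangle-\langle i_\Sigma^*\tilde t',i_\Sigma^*t\rangle .$$ For an abelian group $G$ with an antisymmetric bi-homomorphism $\sigma:G\times G\to\mathbb T$, let $\mathcal A(G)$ be the unital $*$-algebra with linear basis $W(x)$, $x\in G$, and relations $W(x)^*=W(-x)$, $W(x)W(y)=e^{2\pi i\sigma(x,y)}W(x+y)$; let $\mathcal B(G)$ be the Banach $*$-algebra obtained by completing $\mathcal A(G)$ in the norm $\|\sum_j\alpha_jW(x_j)\|_1=\sum_j|\alpha_j|$ ($x_j$ distinct); and let $\mathcal W(G)$ be the enveloping $C^*$-algebra of $\mathcal B(G)$. Then: 1. There is a unique bounded linear functional $\omega_{\mathrm{tor}}:\mathcal W(\mathrm{Top}^k_{\mathrm{tor}}(M))\to\mathbb C$ with $\omega_{\mathrm{tor}}(W(t,\tilde t))=1$ if $t=0$ and $\tilde t=0$, and $\omega_{\mathrm{tor}}(W(t,\tilde t))=0$ otherwise. It is a state, and it is faithful: $\omega_{\mathrm{tor}}(a^*a)=0$ implies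 $a=0$, for all $a\in\mathcal W(\mathrm{Top}^k_{\mathrm{tor}}(M))$. 2. Let $\zeta_{\mathrm{tor}}:\mathrm{Top}^k_{\mathrm{tor}}(M)\to\mathrm{Top}^{m-k}_{\mathrm{tor}}(M)$, $(t,\tilde t)\mapsto(\tilde t,(-1)^{k(m-k)+1}t)$. There is a unique unital $*$-homomorphism $\mathcal W(\zeta_{\mathrm{tor}}):\mathcal W(\mathrm{Top}^k_{\mathrm{tor}}(M))\to\mathcal W(\mathrm{Top}^{m-k}_{\mathrm{tor}}(M))$ with $W(t,\tilde t)\mapsto W(\zeta_{\mathrm{tor}}(t,\tilde t))$, and the functionals of part 1 for $m-k$ and for $k$ satisfy $$\omega_{\mathrm{tor}}\circ\mathcal W(\zeta_{\mathrm{tor}})=\omega_{\mathrm{tor}} .$$ -/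

import Mathlib

open scoped ComplexOrder

noncomputable section

namespace AbelianDuality

universe u v

/-! ## Singular (co)homology -/

/-- Singular `n`-simplices of a topological space. -/
abbrev SingularSimplex (X : Type u) [TopologicalSpace X] (n : ℕ) : Type u :=
  C(stdSimplex ℝ (Fin (n + 1)), X)

theorem val_succAbove {n : ℕ} (i : Fin (n + 1)) (k : Fin n) :
    (i.succAbove k : ℕ) = if (k : ℕ) < i then (k : ℕ) else k + 1 := by
  simp only [Fin.succAbove, Fin.lt_def, Fin.val_castSucc]
  split_ifs <;> simp

namespace SingularSimplex

variable {X : Type u} [TopologicalSpace X]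

/-- Precomposition with the affine map of standard simplices given by a map of vertices. -/
def reindex {m n : ℕ} (f : Fin (m + 1) → Fin (n + 1)) (s : SingularSimplex X n) :
    SingularSimplex X m :=
  s.comp ⟨stdSimplex.map f, stdSimplex.continuous_map f⟩

theorem reindex_reindex {l m n : ℕ} (f : Fin (l + 1) → Fin (m + 1))
    (g : Fin (m + 1) → Fin (n + 1)) (s : SingularSimplex X n) :
    reindex f (reindex g s) = reindex (g ∘ f) s := by
  ext x
  simp [reindex, stdSimplex.map_comp_apply]

/-- The `i`-th face. -/
def face {n : ℕ} (i : Fin (n + 2)) (s : SingularSimplex X (n + 1)) : SingularSimplex X n :=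
  reindex i.succAbove s

theorem face_face {n : ℕ} (s : SingularSimplex X (n + 2)) (i : Fin (n + 2)) (j : Fin (n + 3))
    (h : (j : ℕ) ≤ i) :
    face i (face j s) =
      face (j.castLT (by omega)) (face i.succ s) := by
  simp only [face, reindex_reindex]
  congr 1
  funext k
  ext
  simp [Function.comp, val_succAbove]
  all_goals (try split_ifs) <;> omega

/-- The front `p`-face `[v₀, …, v_p]` of an `n`-simplex. -/
def front {p n : ℕ} (h : p ≤ n) (s : SingularSimplex X n) : SingularSimplex X p :=
  reindex (fun i => ⟨i, by omega⟩) s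

/-- The face `[v_p, …, v_n]` of an `n`-simplex, where `p + q = n`. -/
def back {p q n : ℕ} (h : p + q = n) (s : SingularSimplex X n) : SingularSimplex X q :=
  reindex (fun i => ⟨p + i, by omega⟩) s

end SingularSimplex

open SingularSimplex

section Cohomology

variable (X : Type u) [TopologicalSpace X] (A : Type v) [AddCommGroup A]

/-- Singular `n`-cochains with coefficients in `A`. -/
abbrev Cochain (n : ℕ) : Type (max u v) := SingularSimplex X n → A

variable {X A}

/-- The coboundary operator `(d f)(s) = ∑ᵢ (-1)ⁱ f(∂ᵢ s)`. -/
def coboundary (n : ℕ) : Cochain X A n →+ Cochain X A (n + 1) where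
  toFun f s := ∑ i : Fin (n + 2), (-1 : ℤ) ^ (i : ℕ) • f (face i s)
  map_zero' := by funext s; simp
  map_add' f g := by funext s; simp [Finset.sum_add_distrib]

theorem coboundary_apply (n : ℕ) (f : Cochain X A n) (s : SingularSimplex X (n + 1)) :
    coboundary n f s = ∑ i : Fin (n + 2), (-1 : ℤ) ^ (i : ℕ) • f (face i s) := rfl

theorem coboundary_coboundary (n : ℕ) (f : Cochain X A n) :
    coboundary (n + 1) (coboundary n f) = 0 := by
  funext s
  simp only [coboundary_apply, Pi.zero_apply, Finset.smul_sum]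
  rw [← Finset.sum_product', Finset.univ_product_univ]
  let P := Fin (n + 3) × Fin (n + 2)
  let S : Finset P := {ij : P | (ij.1 : ℕ) ≤ (ij.2 : ℕ)}
  rw [← Finset.sum_add_sum_compl S, ← eq_neg_iff_add_eq_zero, ← Finset.sum_neg_distrib]
  let φ : ∀ ij : P, ij ∈ S → P := fun ij hij =>
    (ij.2.succ, Fin.castLT ij.1 (lt_of_le_of_lt (Finset.mem_filter.mp hij).right (Fin.is_lt ij.2)))
  apply Finset.sum_bij φ
  · intro ij hij
    simp_rw [S, φ, Finset.compl_filter, Finset.mem_filter_univ, Fin.val_succ,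
      Fin.val_castLT] at hij ⊢
    omega
  · rintro ⟨i, j⟩ hij ⟨i', j'⟩ hij' h
    rw [Prod.mk_inj]
    exact ⟨by simpa [φ, Fin.castSucc_castLT] using! congr_arg Fin.castSucc (congr_arg Prod.snd h),
      by simpa [φ] using! congr_arg Prod.fst h⟩
  · rintro ⟨i', j'⟩ hij'
    simp_rw [S, Finset.compl_filter, Finset.mem_filter_univ, not_le] at hij'
    refine ⟨(Fin.castSucc j', i'.pred <| ?_), ?_, ?_⟩
    · rintro rfl
      simp only [Fin.val_zero, not_lt_zero] at hij'
    · simpa [S] using! Nat.le_sub_one_of_lt hij'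
    · simp only [φ, Fin.castLT_castSucc, Fin.succ_pred]
  · rintro ⟨i, j⟩ hij
    have h : (i : ℕ) ≤ j := by simpa [S] using hij
    simp only [φ, smul_smul, ← neg_smul]
    rw [face_face s j i h]
    congr 1
    simp only [Fin.val_succ, Fin.val_castLT, pow_succ]
    ring

/-- Cup product of cochains, `(a ⌣ b)(s) = b[v_p, …, v_n] • a[v₀, …, v_p]`, for
`a` with values in an abelian group and `b` with integer values. -/
def cochainCup {p q n : ℕ} (h : p + q = n) : Cochain X A p →+ Cochain X ℤ q →+ Cochain X A n :=
  AddMonoidHom.mk'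
    (fun a => AddMonoidHom.mk' (fun b s => b (back h s) • a (front (by omega) s))
      (fun b b' => by funext s; simp [add_smul]))
    (fun a a' => by ext b s; simp)

theorem cochainCup_apply {p q n : ℕ} (h : p + q = n) (a : Cochain X A p) (b : Cochain X ℤ q)
    (s : SingularSimplex X n) :
    cochainCup h a b s = b (back h s) • a (front (by omega) s) := rfl

theorem coboundary_cochainCup {p q n : ℕ} (h : p + q = n) (a : Cochain X A p)
    (b : Cochain X ℤ q) :
    coboundary n (cochainCup h a b) =
      cochainCup (by omega) (coboundary p a) b +
        (-1 : ℤ) ^ p • cochainCup (by omega) a (coboundary q b) := by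
  subst h
  funext s
  simp only [coboundary_apply, cochainCup_apply, Pi.add_apply, Pi.smul_apply]
  have e : (p + 1) + (q + 1) = p + q + 2 := by omega
  rw [← (finCongr e).sum_comp, Fin.sum_univ_add]
  rw [Fin.sum_univ_castSucc (n := p + 1), Fin.sum_univ_succ (n := q + 1)]
  have h1 : ∀ i : Fin (p + 1),
      b (back rfl (face (finCongr e (Fin.castAdd (q + 1) i)) s)) •
        a (front (Nat.le_add_right p q) (face (finCongr e (Fin.castAdd (q + 1) i)) s)) =
      b (back (by omega : (p + 1) + q = p + q + 1) s) •
        a (face i.castSucc (front (by omega : p + 1 ≤ p + q + 1) s)) := by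
    intro i
    congr 2
    · simp only [face, back, reindex_reindex]
      congr 1
      funext k
      ext
      simp [Function.comp, val_succAbove]
      split_ifs <;> omega
    · simp only [face, front, reindex_reindex]
      congr 1
      funext k
      ext
      simp [Function.comp, val_succAbove]
      
  have h2 : ∀ i : Fin (q + 1),
      b (back rfl (face (finCongr e (Fin.natAdd (p + 1) i)) s)) •
        a (front (Nat.le_add_right p q) (face (finCongr e (Fin.natAdd (p + 1) i)) s)) =
      b (face i.succ (back (by omega : p + (q + 1) = p + q + 1) s)) •
        a (front (by omega : p ≤ p + q + 1) s) := by
    intro i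
    congr 2
    · simp only [face, back, reindex_reindex]
      congr 1
      funext k
      ext
      simp [Function.comp, val_succAbove]
      all_goals (try split_ifs) <;> omega
    · simp only [face, front, reindex_reindex]
      congr 1
      funext k
      ext
      simp [Function.comp, val_succAbove]
      omega
  have h3 : face (Fin.last (p + 1)) (front (by omega : p + 1 ≤ p + q + 1) s) =
      front (by omega : p ≤ p + q + 1) s := by
    simp only [face, front, reindex_reindex]
    congr 1
    funext k
    ext
    simp [Function.comp]
  have h4 : face 0 (back (by omega : p + (q + 1) = p + q + 1) s) =
      back (by omega : (p + 1) + q = p + q + 1) s := by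
    simp only [face, back, reindex_reindex]
    congr 1
    funext k
    ext
    simp [Function.comp]
    omega
  simp only [h1, h2, h3, h4]
  simp only [smul_add, Finset.smul_sum, add_smul, Finset.sum_smul, smul_smul, finCongr_apply,
    Fin.val_cast, Fin.val_castAdd, Fin.val_natAdd, Fin.val_castSucc, Fin.val_last, Fin.val_succ,
    Fin.val_zero, smul_eq_mul]
  have key : ∀ S1 S2 S2' x y z: A, S2 = S2' → y + z = 0 → S1 + S2 = S1 + y + (z + S2') := by
    intro S1 S2 S2' x y z hS hyz
    rw [hS, add_assoc, ← add_assoc y, hyz, zero_add]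
  have hc : ∀ i : Fin (p + 1), (-1 : ℤ) ^ (i : ℕ) * b (back (by omega : (p + 1) + q = p + q + 1) s)
      = b (back (by omega : (p + 1) + q = p + q + 1) s) * (-1 : ℤ) ^ (i : ℕ) :=
    fun i => mul_comm _ _
  simp only [hc]
  refine key _ _ _ 0 _ _ ?_ ?_
  · refine Finset.sum_congr rfl fun i _ => ?_
    congr 1
    ring
  · rw [← add_smul]
    convert zero_smul ℤ _
    ring

variable (X A)

/-- Singular cocycles. -/
def cocycles (n : ℕ) : AddSubgroup (Cochain X A n) := (coboundary n).ker

/-- Singular coboundaries. -/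
def coboundaries : (n : ℕ) → AddSubgroup (Cochain X A n)
  | 0 => ⊥
  | n + 1 => (coboundary n).range

/-- Singular cohomology `Hⁿ(X; A)`. -/
abbrev Cohomology (n : ℕ) : Type (max u v) :=
  cocycles X A n ⧸ (coboundaries X A n).addSubgroupOf (cocycles X A n)

/-- The torsion subgroup of `Hⁿ(X; ℤ)`. -/
abbrev TorsionCohomology (n : ℕ) : AddSubgroup (Cohomology X ℤ n) :=
  AddCommGroup.torsion (Cohomology X ℤ n)

variable {X A}

theorem mem_cocycles {n : ℕ} {f : Cochain X A n} : f ∈ cocycles X A n ↔ coboundary n f = 0 :=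
  Iff.rfl

/-- The cohomology class of a cocycle. -/
def cohomologyClass {n : ℕ} : cocycles X A n →+ Cohomology X A n :=
  QuotientAddGroup.mk' _

theorem cohomologyClass_eq_zero {n : ℕ} {f : cocycles X A n} :
    cohomologyClass f = 0 ↔ (f : Cochain X A n) ∈ coboundaries X A n := by
  simp [cohomologyClass, AddSubgroup.mem_addSubgroupOf]

theorem cohomologyClass_surjective {n : ℕ} :
    Function.Surjective (cohomologyClass : cocycles X A n → Cohomology X A n) :=
  QuotientAddGroup.mk'_surjective _

/-- A homomorphism out of cohomology from one on cocycles that kills coboundaries. -/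
def Cohomology.lift {n : ℕ} {B : Type*} [AddCommGroup B] (φ : cocycles X A n →+ B)
    (h : ∀ f : cocycles X A n, (f : Cochain X A n) ∈ coboundaries X A n → φ f = 0) :
    Cohomology X A n →+ B :=
  QuotientAddGroup.lift _ φ fun f hf => h f (AddSubgroup.mem_addSubgroupOf.mp hf)

@[simp] theorem Cohomology.lift_class {n : ℕ} {B : Type*} [AddCommGroup B]
    (φ : cocycles X A n →+ B)
    (h : ∀ f : cocycles X A n, (f : Cochain X A n) ∈ coboundaries X A n → φ f = 0)
    (f : cocycles X A n) : Cohomology.lift φ h (cohomologyClass f) = φ f := rfl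

theorem cohomologyClass_eq_add {n : ℕ} {f g g' : cocycles X A n}
    (h : (f : Cochain X A n) = g + g') :
    cohomologyClass f = cohomologyClass g + cohomologyClass g' := by
  rw [← AddMonoidHom.map_add cohomologyClass g g']
  exact congrArg _ (Subtype.ext h)

/-- Pullback of cochains. -/
def Cochain.pullback {Y : Type*} [TopologicalSpace Y] (i : C(X, Y)) (n : ℕ) :
    Cochain Y A n →+ Cochain X A n where
  toFun f s := f (i.comp s)
  map_zero' := rfl
  map_add' _ _ := rfl

theorem Cochain.coboundary_pullback {Y : Type*} [TopologicalSpace Y] (i : C(X, Y)) (n : ℕ)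
    (f : Cochain Y A n) :
    coboundary n (Cochain.pullback i n f) = Cochain.pullback i (n + 1) (coboundary n f) := rfl

/-- Pullback in cohomology along a continuous map. -/
def Cohomology.pullback {Y : Type*} [TopologicalSpace Y] (i : C(X, Y)) (n : ℕ) :
    Cohomology Y A n →+ Cohomology X A n :=
  Cohomology.lift
    (cohomologyClass.comp
      (((Cochain.pullback i n).comp (cocycles Y A n).subtype).codRestrict (cocycles X A n)
        (fun f => by
          rw [mem_cocycles]
          simp [Cochain.coboundary_pullback, mem_cocycles.mp f.2])))
    (by
      rintro ⟨f, hf⟩ hb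
      simp only [AddMonoidHom.coe_comp, Function.comp_apply]
      rw [cohomologyClass_eq_zero]
      cases n with
      | zero =>
        obtain rfl : f = 0 := hb
        exact zero_mem _
      | succ n =>
        obtain ⟨e, he⟩ := hb
        exact ⟨Cochain.pullback i n e, by
          rw [Cochain.coboundary_pullback, he]; rfl⟩)

/-- Pullback of torsion classes. -/
def TorsionCohomology.pullback {Y : Type*} [TopologicalSpace Y] (i : C(X, Y)) (n : ℕ) :
    TorsionCohomology Y n →+ TorsionCohomology X n :=
  ((Cohomology.pullback i n).comp (TorsionCohomology Y n).subtype).codRestrict _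
    (fun t => (Cohomology.pullback i n).isOfFinAddOrder t.2)

theorem cochainCup_mem_cocycles {p q n : ℕ} (h : p + q = n) (a : cocycles X A p)
    (b : cocycles X ℤ q) : cochainCup h (a : Cochain X A p) (b : Cochain X ℤ q) ∈
      cocycles X A n := by
  rw [mem_cocycles, coboundary_cochainCup, mem_cocycles.mp a.2, mem_cocycles.mp b.2]
  simp

/-- The cup product of two cocycles as a cohomology class. -/
def cocycleCup {p q n : ℕ} (h : p + q = n) :
    cocycles X A p →+ cocycles X ℤ q →+ Cohomology X A n :=
  AddMonoidHom.mk'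
    (fun a => AddMonoidHom.mk'
      (fun b => cohomologyClass ⟨cochainCup h (a : Cochain X A p) (b : Cochain X ℤ q),
        cochainCup_mem_cocycles h a b⟩)
      (fun b b' => cohomologyClass_eq_add (by simp)))
    (fun a a' => by
      ext b
      exact cohomologyClass_eq_add (by simp))

theorem cocycleCup_apply {p q n : ℕ} (h : p + q = n) (a : cocycles X A p) (b : cocycles X ℤ q) :
    cocycleCup h a b =
      cohomologyClass ⟨cochainCup h (a : Cochain X A p) (b : Cochain X ℤ q),
        cochainCup_mem_cocycles h a b⟩ := by
  simp only [cocycleCup, AddMonoidHom.mk'_apply]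

theorem cocycleCup_eq_zero_left {p q n : ℕ} (h : p + q = n) (a : cocycles X A p)
    (b : cocycles X ℤ q) (ha : (a : Cochain X A p) ∈ coboundaries X A p) :
    cocycleCup h a b = 0 := by
  rw [cocycleCup_apply, cohomologyClass_eq_zero]
  cases p with
  | zero =>
    obtain ha : (a : Cochain X A 0) = 0 := ha
    simp only [ha, map_zero, AddMonoidHom.zero_apply]
    exact zero_mem _
  | succ p =>
    obtain ⟨e, he⟩ := ha
    obtain rfl : (p + q) + 1 = n := by omega
    refine ⟨cochainCup rfl e (b : Cochain X ℤ q), ?_⟩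
    rw [coboundary_cochainCup, he, mem_cocycles.mp b.2]
    simp

theorem cocycleCup_eq_zero_right {p q n : ℕ} (h : p + q = n) (a : cocycles X A p)
    (b : cocycles X ℤ q) (hb : (b : Cochain X ℤ q) ∈ coboundaries X ℤ q) :
    cocycleCup h a b = 0 := by
  rw [cocycleCup_apply, cohomologyClass_eq_zero]
  cases q with
  | zero =>
    obtain hb : (b : Cochain X ℤ 0) = 0 := hb
    simp only [hb, map_zero]
    exact zero_mem _
  | succ q =>
    obtain ⟨e, he⟩ := hb
    obtain rfl : (p + q) + 1 = n := by omega
    refine ⟨(-1 : ℤ) ^ p • cochainCup rfl (a : Cochain X A p) e, ?_⟩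
    rw [map_zsmul, coboundary_cochainCup, he, mem_cocycles.mp a.2]
    simp [smul_smul, ← mul_pow]

/-- The cup product `Hᵖ(X; A) × H^q(X; ℤ) → Hⁿ(X; A)`, `n = p + q`. -/
def cup {p q n : ℕ} (h : p + q = n) : Cohomology X A p →+ Cohomology X ℤ q →+ Cohomology X A n :=
  Cohomology.lift
    (AddMonoidHom.mk'
      (fun a => Cohomology.lift (cocycleCup h a) (fun b hb => cocycleCup_eq_zero_right h a b hb))
      (fun a a' => by
        refine AddMonoidHom.ext fun c => ?_
        obtain ⟨b, rfl⟩ := cohomologyClass_surjective c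
        simp))
    (fun a ha => by
      refine AddMonoidHom.ext fun c => ?_
      obtain ⟨b, rfl⟩ := cohomologyClass_surjective c
      simp [cocycleCup_eq_zero_left h a b ha])

@[simp] theorem cup_class {p q n : ℕ} (h : p + q = n) (a : cocycles X A p)
    (b : cocycles X ℤ q) : cup h (cohomologyClass a) (cohomologyClass b) = cocycleCup h a b := rfl

/-! ### The Bockstein homomorphism `Hᵖ(X; 𝕋) → Hᵖ⁺¹(X; ℤ)` -/

/-- The change of coefficients on cochains. -/
def Cochain.mapCoeff {A B : Type*} [AddCommGroup A] [AddCommGroup B] (φ : A →+ B) (n : ℕ) :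
    Cochain X A n →+ Cochain X B n where
  toFun f s := φ (f s)
  map_zero' := by funext s; simp
  map_add' f g := by funext s; simp

theorem Cochain.coboundary_mapCoeff {A B : Type*} [AddCommGroup A] [AddCommGroup B] (φ : A →+ B)
    (n : ℕ) (f : Cochain X A n) :
    coboundary n (Cochain.mapCoeff φ n f) = Cochain.mapCoeff φ (n + 1) (coboundary n f) := by
  funext s
  simp [coboundary_apply, Cochain.mapCoeff]

/-- The inclusion `ℤ → ℝ` on cochains. -/
abbrev Cochain.intToReal (n : ℕ) : Cochain X ℤ n →+ Cochain X ℝ n :=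
  Cochain.mapCoeff (Int.castAddHom ℝ) n

/-- The projection `ℝ → 𝕋 = ℝ / ℤ` on cochains. -/
abbrev Cochain.realToCircle (n : ℕ) : Cochain X ℝ n →+ Cochain X UnitAddCircle n :=
  Cochain.mapCoeff (QuotientAddGroup.mk' (AddSubgroup.zmultiples (1 : ℝ))) n

theorem Cochain.intToReal_injective (n : ℕ) :
    Function.Injective (Cochain.intToReal (X := X) n) := by
  intro f g h
  funext s
  have := congrFun h s
  simpa [Cochain.mapCoeff] using this

theorem Cochain.realToCircle_surjective (n : ℕ) :
    Function.Surjective (Cochain.realToCircle (X := X) n) := by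
  intro f
  choose F hF using fun s => QuotientAddGroup.mk'_surjective (AddSubgroup.zmultiples (1 : ℝ)) (f s)
  exact ⟨F, funext hF⟩

theorem Cochain.realToCircle_eq_zero {n : ℕ} {F : Cochain X ℝ n} :
    Cochain.realToCircle n F = 0 ↔ ∃ z, Cochain.intToReal n z = F := by
  constructor
  · intro h
    have h' : ∀ s, ∃ z : ℤ, (z : ℝ) = F s := by
      intro s
      have := congrFun h s
      simp only [Cochain.mapCoeff, AddMonoidHom.coe_mk, ZeroHom.coe_mk, Pi.zero_apply,
        QuotientAddGroup.mk'_apply, QuotientAddGroup.eq_zero_iff,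
        AddSubgroup.mem_zmultiples_iff] at this
      obtain ⟨k, hk⟩ := this
      exact ⟨k, by simpa using hk⟩
    choose z hz using h'
    exact ⟨z, funext hz⟩
  · rintro ⟨z, rfl⟩
    funext s
    simp only [Cochain.mapCoeff, AddMonoidHom.coe_mk, ZeroHom.coe_mk, Pi.zero_apply,
        QuotientAddGroup.mk'_apply, QuotientAddGroup.eq_zero_iff,
        AddSubgroup.mem_zmultiples_iff]
    exact ⟨z s, by simp⟩

/-- `z` represents the Bockstein of the `𝕋`-valued cochain `f`: there is a real lift `F` of `f`
with `d F = z`. -/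
def IsBockstein {p : ℕ} (f : Cochain X UnitAddCircle p) (z : Cochain X ℤ (p + 1)) : Prop :=
  ∃ F : Cochain X ℝ p, Cochain.realToCircle p F = f ∧
    coboundary p F = Cochain.intToReal (p + 1) z

theorem IsBockstein.add {p : ℕ} {f f' : Cochain X UnitAddCircle p} {z z' : Cochain X ℤ (p + 1)}
    (h : IsBockstein f z) (h' : IsBockstein f' z') : IsBockstein (f + f') (z + z') := by
  obtain ⟨F, h1, h2⟩ := h
  obtain ⟨F', h1', h2'⟩ := h'
  exact ⟨F + F', by rw [map_add, h1, h1'], by rw [map_add, map_add, h2, h2']⟩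

theorem IsBockstein.sub {p : ℕ} {f f' : Cochain X UnitAddCircle p} {z z' : Cochain X ℤ (p + 1)}
    (h : IsBockstein f z) (h' : IsBockstein f' z') : IsBockstein (f - f') (z - z') := by
  obtain ⟨F, h1, h2⟩ := h
  obtain ⟨F', h1', h2'⟩ := h'
  exact ⟨F - F', by rw [map_sub, h1, h1'], by rw [map_sub, map_sub, h2, h2']⟩

theorem exists_isBockstein {p : ℕ} (f : cocycles X UnitAddCircle p) :
    ∃ z, IsBockstein (f : Cochain X UnitAddCircle p) z := by
  obtain ⟨F, hF⟩ := Cochain.realToCircle_surjective p (f : Cochain X UnitAddCircle p)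
  have : Cochain.realToCircle (p + 1) (coboundary p F) = 0 := by
    rw [← Cochain.coboundary_mapCoeff, hF, mem_cocycles.mp f.2]
  obtain ⟨z, hz⟩ := Cochain.realToCircle_eq_zero.mp this
  exact ⟨z, F, hF, hz.symm⟩

theorem IsBockstein.mem_cocycles {p : ℕ} {f : Cochain X UnitAddCircle p}
    {z : Cochain X ℤ (p + 1)} (h : IsBockstein f z) : z ∈ cocycles X ℤ (p + 1) := by
  obtain ⟨F, -, h2⟩ := h
  rw [AbelianDuality.mem_cocycles]
  apply Cochain.intToReal_injective
  rw [← Cochain.coboundary_mapCoeff, ← h2, coboundary_coboundary, map_zero]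

theorem IsBockstein.mem_coboundaries {p : ℕ} {f : Cochain X UnitAddCircle p}
    {z : Cochain X ℤ (p + 1)} (h : IsBockstein f z) (hf : f ∈ coboundaries X UnitAddCircle p) :
    z ∈ coboundaries X ℤ (p + 1) := by
  obtain ⟨F, h1, h2⟩ := h
  have key : ∃ E : Cochain X ℝ p, coboundary p E = 0 ∧ Cochain.realToCircle p (F - E) = 0 := by
    cases p with
    | zero =>
      obtain rfl : f = 0 := hf
      exact ⟨0, by simp, by simpa using h1⟩
    | succ p =>
      obtain ⟨e, he⟩ := hf
      obtain ⟨E, hE⟩ := Cochain.realToCircle_surjective p e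
      exact ⟨coboundary p E, coboundary_coboundary p E, by
        rw [map_sub, h1, ← Cochain.coboundary_mapCoeff, hE, he, sub_self]⟩
  obtain ⟨E, hE, hFE⟩ := key
  obtain ⟨w, hw⟩ := Cochain.realToCircle_eq_zero.mp hFE
  refine ⟨w, ?_⟩
  apply Cochain.intToReal_injective
  rw [← Cochain.coboundary_mapCoeff, hw, map_sub, hE, sub_zero, h2]

/-- The Bockstein homomorphism of `0 → ℤ → ℝ → 𝕋 → 0` on cocycles. -/
def cocycleBockstein (p : ℕ) : cocycles X UnitAddCircle p →+ Cohomology X ℤ (p + 1) :=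
  AddMonoidHom.mk'
    (fun f => cohomologyClass ⟨(exists_isBockstein f).choose,
      (exists_isBockstein f).choose_spec.mem_cocycles⟩)
    (fun f f' => by
      rw [← map_add, ← sub_eq_zero, ← map_sub, cohomologyClass_eq_zero]
      have h := (exists_isBockstein (f + f')).choose_spec.sub
        ((exists_isBockstein f).choose_spec.add (exists_isBockstein f').choose_spec)
      refine h.mem_coboundaries ?_
      simp only [AddSubgroup.coe_add, sub_self]
      exact zero_mem _)

/-- The Bockstein homomorphism `Hᵖ(X; 𝕋) → Hᵖ⁺¹(X; ℤ)`. -/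
def bockstein (p : ℕ) : Cohomology X UnitAddCircle p →+ Cohomology X ℤ (p + 1) :=
  Cohomology.lift (cocycleBockstein p) (fun f hf => by
    rw [cocycleBockstein, AddMonoidHom.mk'_apply, cohomologyClass_eq_zero]
    exact (exists_isBockstein f).choose_spec.mem_coboundaries hf)

theorem bockstein_class {p : ℕ} (f : cocycles X UnitAddCircle p) (z : cocycles X ℤ (p + 1))
    (h : IsBockstein (f : Cochain X UnitAddCircle p) (z : Cochain X ℤ (p + 1))) :
    bockstein p (cohomologyClass f) = cohomologyClass z := by
  rw [bockstein, Cohomology.lift_class, cocycleBockstein, AddMonoidHom.mk'_apply, ← sub_eq_zero,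
    ← map_sub, cohomologyClass_eq_zero]
  refine ((exists_isBockstein f).choose_spec.sub h).mem_coboundaries ?_
  rw [sub_self]
  exact zero_mem _

/-- A cohomology class is torsion only if some positive multiple of a representative is exact. -/
theorem exists_nsmul_mem_coboundaries {n : ℕ} (z : cocycles X ℤ n)
    (h : cohomologyClass z ∈ TorsionCohomology X n) :
    ∃ N : ℕ, 0 < N ∧ N • (z : Cochain X ℤ n) ∈ coboundaries X ℤ n := by
  obtain ⟨N, hN, h0⟩ := (isOfFinAddOrder_iff_nsmul_eq_zero).mp
    (show IsOfFinAddOrder (cohomologyClass z) from h)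
  refine ⟨N, hN, ?_⟩
  rw [← map_nsmul, cohomologyClass_eq_zero] at h0
  simpa using h0

theorem exists_bockstein_eq {p : ℕ} (t : TorsionCohomology X (p + 1)) :
    ∃ u, bockstein p u = (t : Cohomology X ℤ (p + 1)) := by
  obtain ⟨t, ht⟩ := t
  obtain ⟨z, rfl⟩ := cohomologyClass_surjective t
  obtain ⟨N, hN, e, he⟩ := exists_nsmul_mem_coboundaries z ht
  have hN' : (N : ℝ) ≠ 0 := by positivity
  let F : Cochain X ℝ p := fun s => (N : ℝ)⁻¹ * e s
  have hF : coboundary p F = Cochain.intToReal (p + 1) z := by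
    funext s
    have h1 := congrArg (Int.cast : ℤ → ℝ) (congrFun he s)
    simp only [coboundary_apply, Pi.smul_apply] at h1
    push_cast at h1
    simp only [coboundary_apply, F, Cochain.mapCoeff]
    simp only [smul_eq_mul, nsmul_eq_mul, zsmul_eq_mul, Int.cast_mul, Int.cast_pow, Int.cast_neg,
      Int.cast_one, Int.cast_natCast] at h1 ⊢
    simp only [AddMonoidHom.coe_mk, ZeroHom.coe_mk, Int.coe_castAddHom]
    rw [eq_comm, ← mul_right_inj' hN', ← h1, Finset.mul_sum]
    refine Finset.sum_congr rfl fun i _ => ?_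
    field_simp
  have hf : Cochain.realToCircle p F ∈ cocycles X UnitAddCircle p := by
    rw [mem_cocycles, Cochain.coboundary_mapCoeff, Cochain.realToCircle_eq_zero]
    exact ⟨z, hF.symm⟩
  exact ⟨cohomologyClass ⟨_, hf⟩, bockstein_class ⟨_, hf⟩ z ⟨F, rfl, hF⟩⟩

theorem cup_eq_zero_of_bockstein_eq_zero {p q n : ℕ} (h : p + q = n)
    {u : Cohomology X UnitAddCircle p} (hu : bockstein p u = 0) (t : TorsionCohomology X q) :
    cup h u (t : Cohomology X ℤ q) = 0 := by
  obtain ⟨f, rfl⟩ := cohomologyClass_surjective u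
  obtain ⟨z, F, hF, hz⟩ := exists_isBockstein f
  have hzc : IsBockstein (f : Cochain X UnitAddCircle p) z := ⟨F, hF, hz⟩
  rw [bockstein_class f ⟨z, hzc.mem_cocycles⟩ hzc, cohomologyClass_eq_zero] at hu
  obtain ⟨w, hw⟩ := hu
  obtain ⟨t, ht⟩ := t
  obtain ⟨b, rfl⟩ := cohomologyClass_surjective t
  obtain ⟨N, hN, hb⟩ := exists_nsmul_mem_coboundaries b ht
  have hN' : (N : ℝ) ≠ 0 := by positivity
  -- a real cocycle lifting `f`
  let G : Cochain X ℝ p := (N : ℝ)⁻¹ • (F - Cochain.intToReal p w)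
  have hG : coboundary p (F - Cochain.intToReal p w) = 0 := by
    rw [map_sub, hz, Cochain.coboundary_mapCoeff, hw, sub_self]
  have hG' : coboundary p G = 0 := by
    funext s
    have := congrFun hG s
    simp only [coboundary_apply] at this ⊢
    simp only [G, Pi.smul_apply, smul_comm _ (N : ℝ)⁻¹, ← Finset.smul_sum, this]
    simp
  have hNG : ∀ s, (N : ℝ) * G s = F s - w s := by
    intro s
    simp only [G, Pi.smul_apply, smul_eq_mul]
    rw [mul_inv_cancel_left₀ hN']
    rfl
  have hcup : cochainCup h (f : Cochain X UnitAddCircle p) (b : Cochain X ℤ q) =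
      Cochain.realToCircle n (cochainCup h G (N • (b : Cochain X ℤ q))) := by
    have h1 : (f : Cochain X UnitAddCircle p) = Cochain.realToCircle p (F - Cochain.intToReal p w) := by
      rw [map_sub, hF, Cochain.realToCircle_eq_zero.mpr ⟨w, rfl⟩, sub_zero]
    rw [h1]
    funext s
    simp only [cochainCup_apply, Cochain.mapCoeff, AddMonoidHom.coe_mk, ZeroHom.coe_mk,
      Pi.smul_apply, Pi.sub_apply]
    rw [← map_zsmul]
    congr 1
    simp only [nsmul_eq_mul, zsmul_eq_mul, Int.cast_mul, Int.cast_natCast]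
    rw [mul_comm (N : ℝ), mul_assoc, hNG]
    rfl
  rw [cup_class, cocycleCup_apply, cohomologyClass_eq_zero]
  simp only [hcup]
  cases q with
  | zero =>
    obtain hb : N • (b : Cochain X ℤ 0) = 0 := hb
    rw [hb, map_zero, map_zero]
    exact zero_mem _
  | succ q =>
    obtain ⟨e, he⟩ := hb
    obtain rfl : (p + q) + 1 = n := by omega
    refine ⟨Cochain.realToCircle (p + q) ((-1 : ℤ) ^ p • cochainCup rfl G e), ?_⟩
    rw [Cochain.coboundary_mapCoeff, map_zsmul, coboundary_cochainCup, he, hG', map_zero,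
      AddMonoidHom.zero_apply, zero_add, smul_smul, ← mul_pow, neg_mul_neg, one_mul, one_pow,
      one_smul]

end Cohomology

/-! ### Singular homology and evaluation -/

section Homology

variable (X : Type u) [TopologicalSpace X]

/-- Singular `n`-chains with integer coefficients. -/
abbrev Chain (n : ℕ) : Type u := SingularSimplex X n →₀ ℤ

variable {X}

/-- The boundary operator `∂ s = ∑ᵢ (-1)ⁱ ∂ᵢ s`. -/
def boundary (n : ℕ) : Chain X (n + 1) →+ Chain X n :=
  Finsupp.liftAddHom fun s =>
    zmultiplesHom _ (∑ i : Fin (n + 2), Finsupp.single (face i s) ((-1 : ℤ) ^ (i : ℕ)))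

variable (X)

/-- Singular cycles. -/
def cycles : (n : ℕ) → AddSubgroup (Chain X n)
  | 0 => ⊤
  | n + 1 => (boundary n).ker

/-- Singular boundaries. -/
def boundaries (n : ℕ) : AddSubgroup (Chain X n) := (boundary n).range

/-- Singular homology `H_n(X; ℤ)`. -/
abbrev Homology (n : ℕ) : Type u :=
  cycles X n ⧸ (boundaries X n).addSubgroupOf (cycles X n)

variable {X} {A : Type v} [AddCommGroup A]

/-- Evaluation of a cochain on chains, `f(∑ mₛ s) = ∑ mₛ f(s)`. -/
def cochainEval {n : ℕ} : Cochain X A n →+ Chain X n →+ A :=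
  AddMonoidHom.mk' (fun f => Finsupp.liftAddHom fun s => zmultiplesHom A (f s))
    (fun f g => by ext s; simp)

@[simp] theorem cochainEval_single {n : ℕ} (f : Cochain X A n) (s : SingularSimplex X n) (m : ℤ) :
    cochainEval f (Finsupp.single s m) = m • f s := by
  simp [cochainEval]

theorem cochainEval_boundary {n : ℕ} (f : Cochain X A n) (c : Chain X (n + 1)) :
    cochainEval f (boundary n c) = cochainEval (coboundary n f) c := by
  induction c using Finsupp.induction_linear with
  | zero => simp
  | add c c' h h' => simp [h, h']
  | single s m =>
    simp [boundary, coboundary_apply]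

/-- The evaluation pairing `Hⁿ(X; A) × H_n(X; ℤ) → A`. -/
def cohomologyEval {n : ℕ} : Cohomology X A n →+ Homology X n →+ A :=
  Cohomology.lift
    (AddMonoidHom.mk'
      (fun f => QuotientAddGroup.lift _ ((cochainEval (f : Cochain X A n)).comp (cycles X n).subtype)
        (by
          rintro ⟨c, hc⟩ hb
          obtain ⟨e, rfl⟩ := AddSubgroup.mem_addSubgroupOf.mp hb
          simp [cochainEval_boundary, mem_cocycles.mp f.2]))
      (fun f g => by
        ext c
        simp))
    (fun f hf => by
      ext c
      obtain ⟨c, hc⟩ := c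
      simp only [AddMonoidHom.mk'_apply, AddMonoidHom.coe_comp, Function.comp_apply,
        QuotientAddGroup.mk'_apply, QuotientAddGroup.lift_mk, AddSubgroup.subtype_apply,
        AddMonoidHom.zero_apply]
      cases n with
      | zero =>
        obtain hf : (f : Cochain X A 0) = 0 := hf
        simp [hf]
      | succ n =>
        obtain ⟨e, he⟩ := hf
        rw [← he, ← cochainEval_boundary, show boundary n c = 0 from hc, map_zero])

end Homology

/-! ### The torsion linking pairing and the torsion topological sector -/

section Linking

variable {S : Type u} [TopologicalSpace S]

/-- `(t, t') ↦ u ⌣ t'`, where `u ∈ Hᵖ(S; 𝕋)` is any class with Bockstein `t`. -/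
def linkingClass {p q n : ℕ} (h : p + q = n) :
    TorsionCohomology S (p + 1) →+ TorsionCohomology S q →+ Cohomology S UnitAddCircle n :=
  AddMonoidHom.mk'
    (fun t => (cup h (exists_bockstein_eq t).choose).comp (TorsionCohomology S q).subtype)
    (fun t t' => by
      ext x
      have h1 := (exists_bockstein_eq (t + t')).choose_spec
      have h2 := (exists_bockstein_eq t).choose_spec
      have h3 := (exists_bockstein_eq t').choose_spec
      have := cup_eq_zero_of_bockstein_eq_zero h
        (u := (exists_bockstein_eq (t + t')).choose -
          ((exists_bockstein_eq t).choose + (exists_bockstein_eq t').choose))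
        (by rw [map_sub, map_add, h1, h2, h3]; simp) x
      rw [map_sub, map_add, AddMonoidHom.sub_apply, AddMonoidHom.add_apply, sub_eq_zero] at this
      exact this)

/-- The defining property: any `u` with Bockstein `t` computes the class. -/
theorem linkingClass_eq {p q n : ℕ} (h : p + q = n) (t : TorsionCohomology S (p + 1))
    (t' : TorsionCohomology S q) (u : Cohomology S UnitAddCircle p)
    (hu : bockstein p u = (t : Cohomology S ℤ (p + 1))) :
    linkingClass h t t' = cup h u (t' : Cohomology S ℤ q) := by
  have h2 := (exists_bockstein_eq t).choose_spec
  have := cup_eq_zero_of_bockstein_eq_zero h (u := (exists_bockstein_eq t).choose - u)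
        (by rw [map_sub, h2, hu, sub_self]) t'
  rw [map_sub, AddMonoidHom.sub_apply, sub_eq_zero] at this
  exact this

/-- The `𝕋`-valued torsion pairing `⟨t, t'⟩ = (u ⌣ t')[S]` between `Hᵖ_tor(S; ℤ)` and
`H^q_tor(S; ℤ)`, `p + q = n + 1`, relative to a class `[S] ∈ H_n(S; ℤ)`; here `u` is any class in
`Hᵖ⁻¹(S; 𝕋)` with Bockstein `t`. For `p = 0` the group `H⁰_tor(S; ℤ)` vanishes and so does the
pairing. -/
def torsionPairing {n : ℕ} (c : Homology S n) : (p q : ℕ) → p + q = n + 1 →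
    TorsionCohomology S p →+ TorsionCohomology S q →+ UnitAddCircle
  | 0, _, _ => 0
  | p + 1, q, h =>
    AddMonoidHom.mk'
      (fun t => ((cohomologyEval (X := S) (A := UnitAddCircle) (n := n)).flip c).comp
        (linkingClass (p := p) (q := q) (n := n) (by omega) t))
      (fun t t' => by ext x; simp)

/-- A presymplectic form on an abelian group: an antisymmetric bi-homomorphism into `𝕋`. -/
structure PresymplecticForm (G : Type*) [AddCommGroup G] where
  /-- the underlying bi-homomorphism -/
  toHom : G →+ G →+ UnitAddCircle
  antisymm : ∀ x y, toHom x y = -toHom y x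

/-- The group `H^{k,l}_tor(X; ℤ) = Hᵏ_tor(X; ℤ) × Hˡ_tor(X; ℤ)`. For a spacetime `M` of dimension
`m` and `l = m - k` this is the torsion topological sector `Topᵏ_tor(M)`. -/
abbrev TopTor (X : Type u) [TopologicalSpace X] (k l : ℕ) : Type u :=
  TorsionCohomology X k × TorsionCohomology X l

/-- Pullback on `H^{k,l}_tor`. -/
def TopTor.pullback {X : Type u} {Y : Type v} [TopologicalSpace X] [TopologicalSpace Y]
    (i : C(X, Y)) (k l : ℕ) : TopTor Y k l →+ TopTor X k l :=
  (TorsionCohomology.pullback i k).prodMap (TorsionCohomology.pullback i l)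

/-- The bi-homomorphism `((t, t̃), (t', t̃')) ↦ ⟨t̃, t'⟩`. -/
def crossPairing {n : ℕ} (c : Homology S n) (k l : ℕ) (h : k + l = n + 1) :
    TopTor S k l →+ TopTor S k l →+ UnitAddCircle :=
  ((torsionPairing c l k (by omega)).comp (AddMonoidHom.snd _ _)).compr₂ (AddMonoidHom.id _)
    |>.compl₂ (AddMonoidHom.fst _ _)

/-- `σ((t, t̃), (t', t̃')) = ⟨t̃, t'⟩ - ⟨t̃', t⟩` on `H^{k,l}_tor(S; ℤ)`. -/
def sigmaTorSurface {n : ℕ} (c : Homology S n) (k l : ℕ) (h : k + l = n + 1) :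
    PresymplecticForm (TopTor S k l) where
  toHom := crossPairing c k l h - (crossPairing c k l h).flip
  antisymm x y := by simp

theorem sigmaTorSurface_apply {n : ℕ} (c : Homology S n) (k l : ℕ) (h : k + l = n + 1)
    (x y : TopTor S k l) : (sigmaTorSurface c k l h).toHom x y =
      torsionPairing c l k (by omega) x.2 y.1 - torsionPairing c l k (by omega) y.2 x.1 := rfl

/-- Pullback of a presymplectic form along a homomorphism. -/
def PresymplecticForm.pullback {G H : Type*} [AddCommGroup G] [AddCommGroup H]
    (σ : PresymplecticForm H) (φ : G →+ H) : PresymplecticForm G where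
  toHom := (σ.toHom.comp φ).compl₂ φ
  antisymm x y := by simpa using σ.antisymm (φ x) (φ y)

/-- The duality `ζ_tor : H^{k,l}_tor → H^{l,k}_tor`, `(t, t̃) ↦ (t̃, (-1)^{kl+1} t)`. -/
def zetaTor (X : Type u) [TopologicalSpace X] (k l : ℕ) : TopTor X k l →+ TopTor X l k where
  toFun x := (x.2, (-1 : ℤ) ^ (k * l + 1) • x.1)
  map_zero' := by simp
  map_add' x y := by simp

end Linking

/-! ## Weyl quantization -/

section Phase

variable {G : Type u} [AddCommGroup G] (σ : PresymplecticForm G)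

/-- The phase `exp(2πi σ(x, y))`. -/
def PresymplecticForm.phase (x y : G) : ℂ := (AddCircle.toCircle (σ.toHom x y) : Circle)

namespace PresymplecticForm

theorem phase_add_left (x y z : G) : σ.phase (x + y) z = σ.phase x z * σ.phase y z := by
  simp [phase, AddCircle.toCircle_add]

theorem phase_add_right (x y z : G) : σ.phase x (y + z) = σ.phase x y * σ.phase x z := by
  simp [phase, AddCircle.toCircle_add]

@[simp] theorem phase_zero_left (x : G) : σ.phase 0 x = 1 := by simp [phase]

@[simp] theorem phase_zero_right (x : G) : σ.phase x 0 = 1 := by simp [phase]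

@[simp] theorem norm_phase (x y : G) : ‖σ.phase x y‖ = 1 := Circle.norm_coe _

theorem phase_neg_neg (x y : G) : σ.phase (-x) (-y) = σ.phase x y := by simp [phase]

theorem star_phase (x y : G) : star (σ.phase x y) = σ.phase y x := by
  rw [phase, phase, σ.antisymm y x, AddCircle.toCircle_neg, Circle.coe_inv_eq_conj]
  rfl

end PresymplecticForm

end Phase

/-- The underlying space of the `*`-algebra `𝒜(G)`: finite linear combinations of the symbols
`W(x)`, `x ∈ G`. The multiplication and involution below are determined by
`W(x) W(y) = exp(2πi σ(x, y)) W(x + y)` and `W(x)* = W(-x)`. -/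
def WeylPre {G : Type u} [AddCommGroup G] (_σ : PresymplecticForm G) : Type u := G →₀ ℂ

namespace WeylPre

variable {G : Type u} [AddCommGroup G] {σ : PresymplecticForm G}

instance : AddCommGroup (WeylPre σ) := inferInstanceAs (AddCommGroup (G →₀ ℂ))
instance : Module ℂ (WeylPre σ) := inferInstanceAs (Module ℂ (G →₀ ℂ))

/-- The element `α W(x)`. -/
def single (x : G) (α : ℂ) : WeylPre σ := Finsupp.single x α

/-- The coefficient of `W(x)`. -/
def coeff (a : WeylPre σ) : G →₀ ℂ := a

@[elab_as_elim]
theorem induction {p : WeylPre σ → Prop} (a : WeylPre σ) (zero : p 0)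
    (add : ∀ a b, p a → p b → p (a + b)) (single : ∀ x α, p (single x α)) : p a :=
  Finsupp.induction_linear (motive := p) a zero add single

theorem single_add (x : G) (α β : ℂ) :
    (single x (α + β) : WeylPre σ) = single x α + single x β := Finsupp.single_add x α β

theorem smul_single (x : G) (c α : ℂ) : c • (single x α : WeylPre σ) = single x (c * α) :=
  Finsupp.smul_single c x α

variable (σ) in
/-- Left multiplication by `W(x)`, namely `W(y) ↦ exp(2πi σ(x, y)) W(x + y)`. -/
def mulBasis (x : G) : WeylPre σ →ₗ[ℂ] WeylPre σ :=
  Finsupp.linearCombination ℂ (M := WeylPre σ) fun y => single (x + y) (σ.phase x y)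

variable (σ) in
/-- The multiplication of `𝒜(G)` as a bilinear map. -/
def mulLin : WeylPre σ →ₗ[ℂ] WeylPre σ →ₗ[ℂ] WeylPre σ :=
  Finsupp.linearCombination ℂ (M := WeylPre σ →ₗ[ℂ] WeylPre σ) (mulBasis σ)

theorem mulLin_single (x y : G) (α β : ℂ) :
    mulLin σ (single x α) (single y β) = single (x + y) (α * β * σ.phase x y) := by
  have h1 : mulLin σ (single x α) = α • mulBasis σ x :=
    Finsupp.linearCombination_single ℂ α x
  have h2 : mulBasis σ x (single y β) = β • (single (x + y) (σ.phase x y) : WeylPre σ) :=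
    Finsupp.linearCombination_single ℂ β y
  rw [h1, LinearMap.smul_apply, h2, smul_single, smul_single, mul_assoc]

instance : Mul (WeylPre σ) := ⟨fun a b => mulLin σ a b⟩
instance : One (WeylPre σ) := ⟨single 0 1⟩

theorem mul_def (a b : WeylPre σ) : a * b = mulLin σ a b := rfl
theorem one_def : (1 : WeylPre σ) = single 0 1 := rfl

/-- `αW(x) βW(y) = αβ exp(2πi σ(x, y)) W(x + y)`. -/
theorem single_mul_single (x y : G) (α β : ℂ) :
    (single x α * single y β : WeylPre σ) = single (x + y) (α * β * σ.phase x y) :=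
  mulLin_single x y α β

instance : Ring (WeylPre σ) where
  __ := (inferInstance : AddCommGroup (WeylPre σ))
  left_distrib a b c := by simp [mul_def]
  right_distrib a b c := by simp [mul_def]
  zero_mul a := by simp [mul_def]
  mul_zero a := by simp [mul_def]
  mul_assoc a b c := by
    induction a using induction with
    | zero => simp [mul_def]
    | add a a' h h' => simp only [mul_def, map_add, LinearMap.add_apply] at h h' ⊢; rw [h, h']
    | single x α =>
      induction b using induction with
      | zero => simp [mul_def]
      | add a a' h h' => simp only [mul_def, map_add, LinearMap.add_apply] at h h' ⊢; rw [h, h']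
      | single y β =>
        induction c using induction with
        | zero => simp [mul_def]
        | add a a' h h' => simp only [mul_def, map_add] at h h' ⊢; rw [h, h']
        | single z γ =>
          simp only [single_mul_single, add_assoc, σ.phase_add_left, σ.phase_add_right]
          congr 1
          ring
  one_mul a := by
    induction a using induction with
    | zero => simp [mul_def]
    | add a a' h h' => simp only [mul_def, map_add] at h h' ⊢; rw [h, h']
    | single x α => simp [one_def, single_mul_single]
  mul_one a := by
    induction a using induction with
    | zero => simp [mul_def]
    | add a a' h h' => simp only [mul_def, map_add, LinearMap.add_apply] at h h' ⊢; rw [h, h']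
    | single x α => simp [one_def, single_mul_single]

instance : Algebra ℂ (WeylPre σ) :=
  Algebra.ofModule (fun c a b => by simp [mul_def]) (fun c a b => by simp [mul_def])

/-- The involution, `(αW(x))* = ᾱ W(-x)`, as an additive map. -/
def starHom : WeylPre σ →+ WeylPre σ :=
  Finsupp.liftAddHom (M := ℂ) (N := WeylPre σ)
    fun x => (Finsupp.singleAddHom (-x) : ℂ →+ (G →₀ ℂ)).comp (starAddEquiv : ℂ ≃+ ℂ).toAddMonoidHom

theorem starHom_single (x : G) (α : ℂ) :
    starHom (single x α : WeylPre σ) = single (-x) (star α) := by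
  unfold starHom single
  exact (Finsupp.liftAddHom_apply_single (N := WeylPre σ) _ x α).trans rfl

instance : Star (WeylPre σ) := ⟨starHom⟩

theorem star_def (a : WeylPre σ) : star a = starHom a := rfl

theorem star_single (x : G) (α : ℂ) :
    star (single x α : WeylPre σ) = single (-x) (star α) := starHom_single x α

instance : StarRing (WeylPre σ) where
  star_involutive a := by
    induction a using induction with
    | zero => simp [star_def]
    | add a a' h h' => simp only [star_def, map_add] at h h' ⊢; rw [h, h']
    | single x α => simp [star_single]
  star_add a b := by simp [star_def]
  star_mul a b := by
    induction a using induction with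
    | zero => simp [star_def]
    | add a a' h h' => simp only [star_def, map_add, add_mul, mul_add] at h h' ⊢; rw [h, h']
    | single x α =>
      induction b using induction with
      | zero => simp [star_def]
      | add a a' h h' => simp only [star_def, map_add, add_mul, mul_add] at h h' ⊢; rw [h, h']
      | single y β =>
        simp only [single_mul_single, star_single, star_mul', σ.star_phase, σ.phase_neg_neg,
          neg_add_rev]
        congr 1
        ring

instance : StarModule ℂ (WeylPre σ) where
  star_smul c a := by
    induction a using induction with
    | zero => simp
    | add a a' h h' => simp only [smul_add, star_add] at h h' ⊢; rw [h, h']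
    | single x α => simp [smul_single, star_single]

/-- The norm `‖∑ αⱼ W(gⱼ)‖₁ = ∑ |αⱼ|`. -/
def ell1Norm (a : WeylPre σ) : ℝ := (coeff a).sum fun _ α => ‖α‖

theorem ell1Norm_eq_sum (a : WeylPre σ) (s : Finset G) (h : (coeff a).support ⊆ s) :
    ell1Norm a = ∑ x ∈ s, ‖coeff a x‖ :=
  Finsupp.sum_of_support_subset _ h _ (by simp)

theorem ell1Norm_zero : ell1Norm (0 : WeylPre σ) = 0 := by
  simpa using ell1Norm_eq_sum (0 : WeylPre σ) ∅ (by
    rw [show coeff (0 : WeylPre σ) = 0 from rfl]; simp)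

theorem ell1Norm_nonneg (a : WeylPre σ) : 0 ≤ ell1Norm a :=
  Finset.sum_nonneg fun _ _ => norm_nonneg _

theorem ell1Norm_single (x : G) (α : ℂ) : ell1Norm (single x α : WeylPre σ) = ‖α‖ :=
  Finsupp.sum_single_index (by simp)

theorem ell1Norm_add_le (a b : WeylPre σ) : ell1Norm (a + b) ≤ ell1Norm a + ell1Norm b := by
  classical
  rw [ell1Norm_eq_sum (a + b) ((coeff a).support ∪ (coeff b).support) Finsupp.support_add,
    ell1Norm_eq_sum a _ Finset.subset_union_left, ell1Norm_eq_sum b _ Finset.subset_union_right,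
    ← Finset.sum_add_distrib]
  exact Finset.sum_le_sum fun x _ => norm_add_le (coeff a x) (coeff b x)

theorem ell1Norm_smul (c : ℂ) (a : WeylPre σ) : ell1Norm (c • a) = ‖c‖ * ell1Norm a := by
  rw [ell1Norm_eq_sum (c • a) (coeff a).support (Finsupp.support_smul (b := c) (g := coeff a)),
    ell1Norm_eq_sum a _ subset_rfl, Finset.mul_sum]
  exact Finset.sum_congr rfl fun x _ => norm_mul c (coeff a x)

theorem ell1Norm_neg (a : WeylPre σ) : ell1Norm (-a) = ell1Norm a := by
  have := ell1Norm_smul (-1) a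
  simpa using this

theorem ell1Norm_eq_zero {a : WeylPre σ} (h : ell1Norm a = 0) : a = 0 := by
  rw [ell1Norm_eq_sum a _ subset_rfl, Finset.sum_eq_zero_iff_of_nonneg
    fun _ _ => norm_nonneg _] at h
  refine Finsupp.ext (f := coeff a) (g := 0) fun x => ?_
  by_contra hx
  exact hx (norm_eq_zero.mp (h x (Finsupp.mem_support_iff.mpr hx)))

theorem eq_sum_single (a : WeylPre σ) :
    a = ∑ x ∈ (coeff a).support, (single x (coeff a x) : WeylPre σ) :=
  (Finsupp.sum_single (coeff a)).symm

theorem ell1Norm_sum_le {ι : Type*} (s : Finset ι) (f : ι → WeylPre σ) :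
    ell1Norm (∑ i ∈ s, f i) ≤ ∑ i ∈ s, ell1Norm (f i) := by
  classical
  induction s using Finset.induction_on with
  | empty => simp [ell1Norm_zero]
  | insert i s hi ih =>
    rw [Finset.sum_insert hi, Finset.sum_insert hi]
    exact (ell1Norm_add_le _ _).trans (by gcongr)

theorem ell1Norm_mul_le (a b : WeylPre σ) : ell1Norm (a * b) ≤ ell1Norm a * ell1Norm b := by
  rw [ell1Norm_eq_sum a _ subset_rfl, ell1Norm_eq_sum b _ subset_rfl, Finset.sum_mul_sum]
  nth_rw 1 [eq_sum_single a, eq_sum_single b, Finset.sum_mul_sum]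
  refine (ell1Norm_sum_le _ _).trans (Finset.sum_le_sum fun x _ => ?_)
  refine (ell1Norm_sum_le _ _).trans (Finset.sum_le_sum fun y _ => ?_)
  rw [single_mul_single, ell1Norm_single]
  simp

theorem ell1Norm_star_le (a : WeylPre σ) : ell1Norm (star a) ≤ ell1Norm a := by
  nth_rw 1 [eq_sum_single a]
  rw [star_sum, ell1Norm_eq_sum a _ subset_rfl]
  refine (ell1Norm_sum_le _ _).trans (Finset.sum_le_sum fun x _ => ?_)
  rw [star_single, ell1Norm_single, norm_star]

instance : NormedRing (WeylPre σ) :=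
  RingNorm.toNormedRing
    { toFun := ell1Norm
      map_zero' := ell1Norm_zero
      add_le' := ell1Norm_add_le
      neg' := ell1Norm_neg
      mul_le' := ell1Norm_mul_le
      eq_zero_of_map_eq_zero' := fun _ => ell1Norm_eq_zero }

theorem norm_def (a : WeylPre σ) : ‖a‖ = ell1Norm a := rfl

instance : NormedAlgebra ℂ (WeylPre σ) where
  norm_smul_le c a := (ell1Norm_smul c a).le

instance : NormedStarGroup (WeylPre σ) where
  norm_star_le a := ell1Norm_star_le a

end WeylPre

/-! ### Completion of a seminormed `*`-algebra -/

section StarCompletion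

open UniformSpace

variable {A : Type u} [SeminormedRing A] [StarRing A]

instance : Star (Completion A) := ⟨Completion.map star⟩

theorem completion_continuous_star : Continuous (star : Completion A → Completion A) :=
  Completion.continuous_map

variable [NormedStarGroup A]

theorem completion_coe_star (a : A) : ((star a : A) : Completion A) = star (a : Completion A) :=
  (Completion.map_coe star_isometry.uniformContinuous a).symm

instance : StarRing (Completion A) where
  star_involutive a := by
    induction a using Completion.induction_on with
    | hp => exact isClosed_eq (completion_continuous_star.comp completion_continuous_star)
              continuous_id
    | ih a => rw [← completion_coe_star, ← completion_coe_star, star_star]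
  star_add a b := by
    induction a, b using Completion.induction_on₂ with
    | hp => exact isClosed_eq (completion_continuous_star.comp (by fun_prop))
              ((completion_continuous_star.comp continuous_fst).add
                (completion_continuous_star.comp continuous_snd))
    | ih a b =>
      rw [← Completion.coe_add]
      simp only [← completion_coe_star]
      rw [star_add, Completion.coe_add]
  star_mul a b := by
    induction a, b using Completion.induction_on₂ with
    | hp => exact isClosed_eq (completion_continuous_star.comp (by fun_prop))
              ((completion_continuous_star.comp continuous_snd).mul
                (completion_continuous_star.comp continuous_fst))
    | ih a b =>
      rw [← Completion.coe_mul]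
      simp only [← completion_coe_star]
      rw [star_mul, Completion.coe_mul]

instance : NormedStarGroup (Completion A) where
  norm_star_le a := by
    induction a using Completion.induction_on with
    | hp => exact isClosed_le (continuous_norm.comp completion_continuous_star) continuous_norm
    | ih a => rw [← completion_coe_star, Completion.norm_coe, Completion.norm_coe, norm_star]

variable [NormedAlgebra ℂ A]

instance : NormedAlgebra ℂ (Completion A) where
  norm_smul_le := norm_smul_le

instance [StarModule ℂ A] : StarModule ℂ (Completion A) where
  star_smul c a := by
    induction a using Completion.induction_on with
    | hp =>
      have h1 : Continuous fun a : Completion A => star (c • a) :=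
        completion_continuous_star.comp (continuous_const_smul c)
      have h2 : Continuous fun a : Completion A => star c • star a :=
        (continuous_const_smul (star c)).comp completion_continuous_star
      exact isClosed_eq h1 h2
    | ih a =>
      rw [← Completion.coe_smul, ← completion_coe_star, ← completion_coe_star, star_smul,
        Completion.coe_smul]

end StarCompletion

/-- The Banach `*`-algebra `ℬ(G)`: the completion of `𝒜(G)` in the norm `‖·‖₁`. -/
abbrev WeylBanach {G : Type u} [AddCommGroup G] (σ : PresymplecticForm G) : Type u :=
  UniformSpace.Completion (WeylPre σ)

/-! ### The enveloping C*-algebra of a Banach `*`-algebra -/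

section Envelope

variable (B : Type u) [NormedRing B] [StarRing B] [NormedAlgebra ℂ B]

/-- C*-seminorms `p` on a Banach `*`-algebra; those are exactly the functions `b ↦ ‖π(b)‖` for
`π` a `*`-representation on a Hilbert space. (The bound `p ≤ ‖·‖` holds for every such `π` when
`B` is complete with isometric involution.) -/
structure CStarSeminorm extends Seminorm ℂ B where
  mul_le' : ∀ a b, toFun (a * b) ≤ toFun a * toFun b
  star_mul_self' : ∀ a, toFun (star a * a) = toFun a * toFun a
  le_norm' : ∀ a, toFun a ≤ ‖a‖

variable {B}

theorem CStarSeminorm.star_le (p : CStarSeminorm B) (a : B) :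
    p.toSeminorm (star a) ≤ p.toSeminorm a := by
  have h1 : p.toSeminorm (star (star a) * star a) = p.toSeminorm (star a) * p.toSeminorm (star a) :=
    p.star_mul_self' (star a)
  have h2 : p.toSeminorm (star (star a) * star a) ≤ p.toSeminorm a * p.toSeminorm (star a) := by
    rw [star_star]; exact p.mul_le' a (star a)
  rcases (apply_nonneg p.toSeminorm (star a)).eq_or_lt with h | h
  · rw [← h]; exact apply_nonneg _ _
  · exact le_of_mul_le_mul_right (h1 ▸ h2) h

instance : Nonempty (CStarSeminorm B) :=
  ⟨{ (0 : Seminorm ℂ B) with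
      mul_le' := fun a b => by
        change (0 : Seminorm ℂ B) (a * b) ≤ (0 : Seminorm ℂ B) a * (0 : Seminorm ℂ B) b
        simp
      star_mul_self' := fun a => by
        change (0 : Seminorm ℂ B) (star a * a) = (0 : Seminorm ℂ B) a * (0 : Seminorm ℂ B) a
        simp
      le_norm' := fun a => by
        change (0 : Seminorm ℂ B) a ≤ ‖a‖
        simp }⟩

/-- The largest C*-seminorm, `b ↦ sup ‖π(b)‖`. -/
def maxCStarSeminorm (b : B) : ℝ := ⨆ p : CStarSeminorm B, p.toSeminorm b

theorem bddAbove_cstarSeminorm (b : B) :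
    BddAbove (Set.range fun p : CStarSeminorm B => p.toSeminorm b) :=
  ⟨‖b‖, by rintro _ ⟨p, rfl⟩; exact p.le_norm' b⟩

theorem le_maxCStarSeminorm (p : CStarSeminorm B) (b : B) :
    p.toSeminorm b ≤ maxCStarSeminorm b := le_ciSup (bddAbove_cstarSeminorm b) p

theorem maxCStarSeminorm_le {b : B} {r : ℝ} (h : ∀ p : CStarSeminorm B, p.toSeminorm b ≤ r) :
    maxCStarSeminorm b ≤ r := ciSup_le h

theorem maxCStarSeminorm_nonneg (b : B) : 0 ≤ maxCStarSeminorm b :=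
  (apply_nonneg _ _).trans (le_maxCStarSeminorm (Classical.arbitrary _) b)

theorem maxCStarSeminorm_mul_le (a b : B) :
    maxCStarSeminorm (a * b) ≤ maxCStarSeminorm a * maxCStarSeminorm b :=
  maxCStarSeminorm_le fun p => (p.mul_le' a b).trans
    (mul_le_mul (le_maxCStarSeminorm p a) (le_maxCStarSeminorm p b) (apply_nonneg p.toSeminorm b)
      (maxCStarSeminorm_nonneg a))

theorem maxCStarSeminorm_star_mul_self (a : B) :
    maxCStarSeminorm a * maxCStarSeminorm a ≤ maxCStarSeminorm (star a * a) := by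
  have h : maxCStarSeminorm a ≤ Real.sqrt (maxCStarSeminorm (star a * a)) :=
    maxCStarSeminorm_le fun p => Real.le_sqrt_of_sq_le (by
      have h1 : p.toSeminorm (star a * a) = p.toSeminorm a * p.toSeminorm a := p.star_mul_self' a
      rw [sq, ← h1]
      exact le_maxCStarSeminorm p _)
  calc _ ≤ Real.sqrt (maxCStarSeminorm (star a * a)) * Real.sqrt (maxCStarSeminorm (star a * a)) :=
        mul_le_mul h h (maxCStarSeminorm_nonneg a) (Real.sqrt_nonneg _)
    _ = _ := Real.mul_self_sqrt (maxCStarSeminorm_nonneg _)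

variable (B) in
/-- A copy of `B`, seminormed by the largest C*-seminorm. -/
def EnvelopePre : Type u := B

instance : Ring (EnvelopePre B) := inferInstanceAs (Ring B)
instance : StarRing (EnvelopePre B) := inferInstanceAs (StarRing B)
instance : Algebra ℂ (EnvelopePre B) := inferInstanceAs (Algebra ℂ B)
instance [StarModule ℂ B] : StarModule ℂ (EnvelopePre B) := inferInstanceAs (StarModule ℂ B)

instance : SeminormedRing (EnvelopePre B) :=
  RingSeminorm.toSeminormedRing (R := EnvelopePre B)
    { toFun := fun b => maxCStarSeminorm (B := B) b
      map_zero' := le_antisymm (maxCStarSeminorm_le fun p => (map_zero p.toSeminorm).le)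
        (maxCStarSeminorm_nonneg _)
      add_le' := fun a b => maxCStarSeminorm_le fun p =>
        (map_add_le_add p.toSeminorm (a : B) (b : B)).trans
          (add_le_add (le_maxCStarSeminorm p _) (le_maxCStarSeminorm p _))
      neg' := fun a => by
        unfold maxCStarSeminorm
        congr 1
        funext p
        exact map_neg_eq_map p.toSeminorm (a : B)
      mul_le' := fun a b => maxCStarSeminorm_mul_le (B := B) a b }

instance : NormedAlgebra ℂ (EnvelopePre B) where
  norm_smul_le c a := maxCStarSeminorm_le (B := B) fun p =>
    (map_smul_eq_mul p.toSeminorm c (a : B)).le.trans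
      (mul_le_mul_of_nonneg_left (le_maxCStarSeminorm p _) (norm_nonneg c))

instance : NormedStarGroup (EnvelopePre B) where
  norm_star_le a := maxCStarSeminorm_le (B := B) fun p =>
    (p.star_le (a : B)).trans (le_maxCStarSeminorm p _)

theorem EnvelopePre.norm_mul_self_le (a : EnvelopePre B) : ‖a‖ * ‖a‖ ≤ ‖star a * a‖ :=
  maxCStarSeminorm_star_mul_self (B := B) a

variable (B) in
/-- The enveloping C*-algebra of a Banach `*`-algebra `B`: the Hausdorff completion of `B` in its
largest C*-seminorm. -/
abbrev EnvelopingCStar : Type u := UniformSpace.Completion (EnvelopePre B)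

instance : CStarRing (EnvelopingCStar B) where
  norm_mul_self_le a := by
    induction a using UniformSpace.Completion.induction_on with
    | hp => exact isClosed_le (continuous_norm.mul continuous_norm)
              (continuous_norm.comp (completion_continuous_star.mul continuous_id))
    | ih a =>
      rw [← completion_coe_star, ← UniformSpace.Completion.coe_mul,
        UniformSpace.Completion.norm_coe, UniformSpace.Completion.norm_coe]
      exact a.norm_mul_self_le

instance [StarModule ℂ B] : CStarAlgebra (EnvelopingCStar B) where

end Envelope

/-- The canonical map from a Banach `*`-algebra to its enveloping C*-algebra. -/
def toEnvelope {B : Type u} [NormedRing B] [StarRing B] [NormedAlgebra ℂ B] (b : B) :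
    EnvelopingCStar B :=
  UniformSpace.Completion.coe' (show EnvelopePre B from b)

/-- The Weyl C*-algebra `𝒲(G) = C*(ℬ(G))` of a presymplectic abelian group. -/
abbrev WeylAlgebra {G : Type u} [AddCommGroup G] (σ : PresymplecticForm G) : Type u :=
  EnvelopingCStar (WeylBanach σ)

/-- The generator `W(x)` of the Weyl C*-algebra. -/
def weyl {G : Type u} [AddCommGroup G] (σ : PresymplecticForm G) (x : G) : WeylAlgebra σ :=
  toEnvelope ((WeylPre.single x 1 : WeylPre σ) : WeylBanach σ)

/-- The Weyl relations `W(x) W(y) = exp(2πi σ(x, y)) W(x + y)`. -/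
theorem weyl_mul {G : Type u} [AddCommGroup G] (σ : PresymplecticForm G) (x y : G) :
    weyl σ x * weyl σ y = σ.phase x y • weyl σ (x + y) := by
  have h : (WeylPre.single x 1 * WeylPre.single y 1 : WeylPre σ) =
      σ.phase x y • WeylPre.single (x + y) 1 := by
    rw [WeylPre.single_mul_single, WeylPre.smul_single]
    simp
  have h2 := congrArg (fun a : WeylPre σ => toEnvelope (a : WeylBanach σ)) h
  simp only [UniformSpace.Completion.coe_mul, UniformSpace.Completion.coe_smul] at h2
  unfold toEnvelope at h2
  exact (UniformSpace.Completion.coe_mul (α := EnvelopePre (WeylBanach σ)) _ _).symm.trans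
    (h2.trans ((UniformSpace.Completion.toComplₗᵢ (𝕜 := ℂ)
      (E := EnvelopePre (WeylBanach σ))).map_smul _ _))

/-- The Weyl relations `W(x)* = W(-x)`. -/
theorem weyl_star {G : Type u} [AddCommGroup G] (σ : PresymplecticForm G) (x : G) :
    star (weyl σ x) = weyl σ (-x) := by
  have h : star (WeylPre.single x 1 : WeylPre σ) = WeylPre.single (-x) 1 := by
    rw [WeylPre.star_single, star_one]
  have h2 := congrArg (fun a : WeylPre σ => toEnvelope (a : WeylBanach σ)) h
  simp only [completion_coe_star] at h2
  exact (completion_coe_star (A := EnvelopePre (WeylBanach σ)) _).symm.trans h2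

/-- `W(0)` is the unit. -/
theorem weyl_zero {G : Type u} [AddCommGroup G] (σ : PresymplecticForm G) : weyl σ 0 = 1 := rfl

/-- A state on a unital C*-algebra: a normalized positive bounded linear functional. -/
def IsState {A : Type u} [CStarAlgebra A] (φ : A →L[ℂ] ℂ) : Prop :=
  φ 1 = 1 ∧ ∀ a, 0 ≤ φ (star a * a)

/-- A positive functional is faithful if `φ(a* a) = 0` only for `a = 0`. -/
def IsFaithful {A : Type u} [CStarAlgebra A] (φ : A →L[ℂ] ℂ) : Prop :=
  ∀ a, φ (star a * a) = 0 → a = 0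

/-! ## Globally hyperbolic spacetimes with a compact spacelike Cauchy surface -/

section Spacetime

open scoped Manifold ContDiff Topology
open Bundle Filter

section Lorentz

variable (d : ℕ) (M : Type u) [TopologicalSpace M] [ChartedSpace (EuclideanSpace ℝ (Fin d)) M]
  [IsManifold (𝓡 d) ∞ M]

/-- A smooth Lorentzian metric, of signature `(-, +, …, +)`: at every point there is a timelike
vector on whose orthogonal complement the metric is positive definite. -/
structure LorentzMetric where
  /-- the metric at a point -/
  val (x : M) : TangentSpace (𝓡 d) x →L[ℝ] TangentSpace (𝓡 d) x →L[ℝ] ℝ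
  symm (x : M) (v w : TangentSpace (𝓡 d) x) : val x v w = val x w v
  signature (x : M) : ∃ v : TangentSpace (𝓡 d) x, val x v v < 0 ∧
    ∀ w : TangentSpace (𝓡 d) x, val x v w = 0 → w ≠ 0 → 0 < val x w w
  contMDiff : ContMDiff (𝓡 d)
    ((𝓡 d).prod 𝓘(ℝ, EuclideanSpace ℝ (Fin d) →L[ℝ] EuclideanSpace ℝ (Fin d) →L[ℝ] ℝ)) ∞
    (fun x => TotalSpace.mk'
      (EuclideanSpace ℝ (Fin d) →L[ℝ] EuclideanSpace ℝ (Fin d) →L[ℝ] ℝ) x (val x))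

/-- A family of vectors is a positively oriented basis. -/
def IsPositiveBasis {d : ℕ} {V : Type*} [AddCommGroup V] [Module ℝ V]
    (o : Orientation ℝ V (Fin d)) (v : Fin d → V) : Prop :=
  ∃ b : Module.Basis (Fin d) ℝ V, ⇑b = v ∧ b.orientation = o

/-- An orientation of a manifold of positive dimension: a choice of orientation of every tangent
space such that around every point there is a positively oriented continuous local frame. -/
structure ManifoldOrientation where
  /-- the orientation of the tangent space at a point -/
  val (x : M) : Orientation ℝ (TangentSpace (𝓡 d) x) (Fin d)
  exists_frame (x₀ : M) : ∃ U ∈ 𝓝 x₀, ∃ X : Fin d → (x : M) → TangentSpace (𝓡 d) x,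
    (∀ i, ContinuousOn (fun x => (⟨x, X i x⟩ : TangentBundle (𝓡 d) M)) U) ∧
    ∀ x ∈ U, IsPositiveBasis (val x) (fun i => X i x)

variable {d M}

/-- A time-orientation, given by a smooth timelike vector field (declared future-directed). -/
structure TimeOrientation (g : LorentzMetric d M) where
  /-- the vector field -/
  val (x : M) : TangentSpace (𝓡 d) x
  contMDiff : ContMDiff (𝓡 d) (𝓡 d).tangent ∞ (fun x => (⟨x, val x⟩ : TangentBundle (𝓡 d) M))
  timelike (x : M) : g.val x (val x) (val x) < 0

/-- Timelike curves, parametrized by the real line. -/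
def IsTimelikeCurve (g : LorentzMetric d M) (γ : ℝ → M) : Prop :=
  ContMDiff 𝓘(ℝ, ℝ) (𝓡 d) 1 γ ∧
    ∀ t : ℝ, g.val (γ t) (mfderiv 𝓘(ℝ, ℝ) (𝓡 d) γ t (1 : ℝ))
      (mfderiv 𝓘(ℝ, ℝ) (𝓡 d) γ t (1 : ℝ)) < 0

/-- A curve without endpoints. -/
def IsInextendible {M : Type*} [TopologicalSpace M] (γ : ℝ → M) : Prop :=
  ∀ p, ¬ Tendsto γ atTop (𝓝 p) ∧ ¬ Tendsto γ atBot (𝓝 p)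

/-- A Cauchy surface: a subset met exactly once by every inextendible timelike curve. -/
def IsCauchySurface (g : LorentzMetric d M) (C : Set M) : Prop :=
  ∀ γ : ℝ → M, IsTimelikeCurve g γ → IsInextendible γ → ∃! t, γ t ∈ C

end Lorentz

variable (n : ℕ) (M : Type u) [TopologicalSpace M]
  [ChartedSpace (EuclideanSpace ℝ (Fin (n + 1))) M] [IsManifold (𝓡 (n + 1)) ∞ M]
  (S : Type v) [TopologicalSpace S]
  [ChartedSpace (EuclideanSpace ℝ (Fin n)) S] [IsManifold (𝓡 n) ∞ S]

/-- The structure of a globally hyperbolic spacetime on the `(n+1)`-dimensional manifold `M`,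
together with a smooth spacelike Cauchy surface given by an embedding of the manifold `S`.
(Global hyperbolicity is the existence of a Cauchy surface.) -/
structure CauchySpacetime where
  /-- the Lorentzian metric -/
  metric : LorentzMetric (n + 1) M
  /-- the time-orientation -/
  time : TimeOrientation metric
  /-- the orientation -/
  orientation : ManifoldOrientation (n + 1) M
  /-- the embedding `S → M` -/
  incl : C(S, M)
  isSmoothEmbedding : Manifold.IsSmoothEmbedding (𝓡 n) (𝓡 (n + 1)) ∞ incl
  spacelike : ∀ (x : S) (v : TangentSpace (𝓡 n) x), v ≠ 0 →
    0 < metric.val (incl x) (mfderiv (𝓡 n) (𝓡 (n + 1)) incl x v)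
      (mfderiv (𝓡 n) (𝓡 (n + 1)) incl x v)
  isCauchySurface : IsCauchySurface metric (Set.range incl)

namespace CauchySpacetime

variable {n M S} (D : CauchySpacetime n M S)

open Classical in
/-- The sign of a basis of a tangent space of `S` for the orientation induced by the orientation and
time-orientation of `M`: `v` is positive if `(T, v₁, …, v_n)` is positively oriented in `M`, for
future-directed timelike `T`. -/
def inducedSign (x : S) (v : Fin n → TangentSpace (𝓡 n) x) : ℤ :=
  if IsPositiveBasis (D.orientation.val (D.incl x))
    (Fin.cons (D.time.val (D.incl x)) fun i => mfderiv (𝓡 n) (𝓡 (n + 1)) D.incl x (v i) :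
      Fin (n + 1) → TangentSpace (𝓡 (n + 1)) (D.incl x))
  then 1 else -1

end CauchySpacetime

/-- Chains in `S` that are supported in the complement of the point `x`. -/
def chainsAvoiding {S : Type v} [TopologicalSpace S] (x : S) (n : ℕ) : AddSubgroup (Chain S n) :=
  AddSubgroup.closure {c | ∃ s : SingularSimplex S n, x ∉ Set.range s ∧ c = Finsupp.single s 1}

namespace CauchySpacetime

variable {n M S} (D : CauchySpacetime n M S)

/-- `c` is the fundamental class of `S` (with the induced orientation): for every point `x`, its
image in the local homology `H_n(S, S ∖ {x}; ℤ)` is the local orientation class. The latter is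
represented by any singular simplex `s` which is affine in the chart at `x`, with vertices
`w₀, …, w_n` and containing `x` in its interior, taken with the sign of the basis
`(w₁ - w₀, …, w_n - w₀)`. -/
def IsFundamentalClass (c : Homology S n) : Prop :=
  ∀ (x : S) (w : Fin (n + 1) → EuclideanSpace ℝ (Fin n)) (s : SingularSimplex S n),
    (∀ t, s t ∈ (chartAt (EuclideanSpace ℝ (Fin n)) x).source ∧
      chartAt (EuclideanSpace ℝ (Fin n)) x (s t) = ∑ i, t i • w i) →
    chartAt (EuclideanSpace ℝ (Fin n)) x x ∈ interior (convexHull ℝ (Set.range w)) →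
    ∃ z : cycles S n, QuotientAddGroup.mk z = c ∧
      (z : Chain S n) - Finsupp.single s (D.inducedSign x fun i =>
        (mfderiv (𝓡 n) 𝓘(ℝ, EuclideanSpace ℝ (Fin n))
          (chartAt (EuclideanSpace ℝ (Fin n)) x) x).inverse (w i.succ - w 0)) ∈
        chainsAvoiding x n ⊔ boundaries S n

open Classical in
/-- The fundamental class `[S] ∈ H_n(S; ℤ)` of the compact Cauchy surface. (It exists and is unique
for compact `S`; the value `0` is never taken then.) -/
def fundamentalClass : Homology S n :=
  if h : ∃ c, D.IsFundamentalClass c then h.choose else 0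

/-- The form `σ_tor` on `Topᵏ_tor(M) = H^{k,l}_tor(M; ℤ)`, `k + l = n + 1 = dim M`. -/
def sigmaTor (k l : ℕ) (h : k + l = n + 1) : PresymplecticForm (TopTor M k l) :=
  (sigmaTorSurface D.fundamentalClass k l h).pullback (TopTor.pullback D.incl k l)

/-- The C*-algebra `𝒲(Topᵏ_tor(M))`. -/
abbrev TorWeylAlgebra (k l : ℕ) (h : k + l = n + 1) : Type u :=
  WeylAlgebra (D.sigmaTor k l h)

/-- `φ` takes the values `φ(W(t, t̃)) = 1` for `(t, t̃) = 0`, and `0` otherwise. -/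
def IsTorFunctional {k l : ℕ} {h : k + l = n + 1} (φ : D.TorWeylAlgebra k l h →L[ℂ] ℂ) : Prop :=
  (φ (weyl _ 0) = 1) ∧ ∀ x : TopTor M k l, x ≠ 0 → φ (weyl _ x) = 0

/-- `Z` extends `W(x) ↦ W(ζ_tor x)`, so that it is the quantum duality `𝒲(ζ_tor)`. -/
def IsTorDuality {k l : ℕ} {h : k + l = n + 1} {h' : l + k = n + 1}
    (Z : D.TorWeylAlgebra k l h →⋆ₐ[ℂ] D.TorWeylAlgebra l k h') : Prop :=
  ∀ x : TopTor M k l, Z (weyl _ x) = weyl _ (zetaTor M k l x)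

end CauchySpacetime

end Spacetime

end AbelianDuality

end

/-!
The Weyl algebra `𝒲(G)` has the universal property that `*`-homomorphisms out of it correspond to
Weyl systems: `ℬ(G)` represents every Weyl system contractively, and the largest C*-seminorm
dominates every such representation. Applied to twisted translations on `ℓ²(G)` it gives the regular
representation, whose vector state at `δ₀` is the canonical trace `ω`.

If `G` is a torsion group, finitely many elements of `G` generate a finite subgroup `H`. The span of
`W(x)`, `x ∈ H`, is a finite-dimensional C*-algebra on which the regular representation is
injective, hence isometric; by density the regular representation of `𝒲(G)` is isometric. As `ω` is
a trace, `ω(a* a) = 0` forces `a` to annihilate not only `δ₀` but all `δ_x`, so that `a = 0`.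

The duality `ζ` preserves `σ` because of the symmetry `⟨t, t'⟩ = (-1)^{kl} ⟨t', t⟩` of the linking
pairing: up to the coboundary of a product of real lifts, it is the graded commutativity of the cup
product, which holds because the signed reversal of the vertices of a simplex is chain homotopic to
the identity and interchanges front and back faces. Finally `ω ∘ 𝒲(ζ)` has the values characterizing
`ω`, as `ζ` is injective.
-/

noncomputable section

namespace AbelianDuality

universe u v w

/-! ### Universal property of the Weyl algebra -/

section CompletionLift

open UniformSpace

variable {A : Type u} [SeminormedRing A] [StarRing A] [NormedAlgebra ℂ A]
  {C : Type v} [CStarAlgebra C]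

theorem continuous_of_norm_le (f : A →⋆ₐ[ℂ] C) (hf : ∀ a, ‖f a‖ ≤ ‖a‖) :
    Continuous (f : A →+* C) :=
  AddMonoidHomClass.continuous_of_bound f 1 (by simpa using hf)

variable [NormedStarGroup A]

/-- The extension of a contractive `*`-homomorphism to the completion; it provides the maps out of
`ℬ(G)` and out of enveloping C*-algebras. -/
def completionLift (f : A →⋆ₐ[ℂ] C) (hf : ∀ a, ‖f a‖ ≤ ‖a‖) : Completion A →⋆ₐ[ℂ] C where
  __ := Completion.extensionHom (f : A →+* C) (continuous_of_norm_le f hf)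
  commutes' c :=
    (Completion.extensionHom_coe (f : A →+* C) (continuous_of_norm_le f hf) _).trans
      (AlgHomClass.commutes f c)
  map_star' a := by
    induction a using Completion.induction_on with
    | hp =>
      exact isClosed_eq (Completion.continuous_extension.comp completion_continuous_star)
        (continuous_star.comp Completion.continuous_extension)
    | ih a =>
      rw [← completion_coe_star]
      exact (Completion.extensionHom_coe (f : A →+* C) (continuous_of_norm_le f hf) _).trans <|
        (map_star f a).trans <| congrArg star
          (Completion.extensionHom_coe (f : A →+* C) (continuous_of_norm_le f hf) a).symm

theorem completionLift_coe (f : A →⋆ₐ[ℂ] C) (hf : ∀ a, ‖f a‖ ≤ ‖a‖) (a : A) :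
    completionLift f hf (a : Completion A) = f a :=
  Completion.extensionHom_coe (f : A →+* C) (continuous_of_norm_le f hf) a

theorem norm_completionLift_le (f : A →⋆ₐ[ℂ] C) (hf : ∀ a, ‖f a‖ ≤ ‖a‖) (a : Completion A) :
    ‖completionLift f hf a‖ ≤ ‖a‖ := by
  induction a using Completion.induction_on with
  | hp => exact isClosed_le (continuous_norm.comp Completion.continuous_extension) continuous_norm
  | ih a => simpa only [completionLift_coe, Completion.norm_coe] using hf a

end CompletionLift

section EnvelopeLift

open UniformSpace

variable {B : Type u} [NormedRing B] [StarRing B] [NormedAlgebra ℂ B]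
  {C : Type v} [CStarAlgebra C]

/-- The C*-seminorm `b ↦ ‖f b‖` of a contractive `*`-homomorphism `f` into a C*-algebra; it shows
that `f` is contractive for the enveloping norm. -/
def CStarSeminorm.ofHom (f : B →⋆ₐ[ℂ] C) (hf : ∀ a, ‖f a‖ ≤ ‖a‖) : CStarSeminorm B where
  __ := (normSeminorm ℂ C).comp (f : B →ₗ[ℂ] C)
  mul_le' a b := (congrArg norm (map_mul f a b)).trans_le (norm_mul_le _ _)
  star_mul_self' a :=
    (congrArg norm (by rw [map_mul, map_star] : f (star a * a) = star (f a) * f a)).trans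
      CStarRing.norm_star_mul_self
  le_norm' := hf

/-- The extension of a contractive `*`-homomorphism to the enveloping C*-algebra, that is, the
universal property of the latter. -/
def envelopeLift (f : B →⋆ₐ[ℂ] C) (hf : ∀ a, ‖f a‖ ≤ ‖a‖) : EnvelopingCStar B →⋆ₐ[ℂ] C :=
  completionLift (A := EnvelopePre B) f
    (fun a => le_maxCStarSeminorm (CStarSeminorm.ofHom f hf) a)

theorem envelopeLift_toEnvelope (f : B →⋆ₐ[ℂ] C) (hf : ∀ a, ‖f a‖ ≤ ‖a‖) (b : B) :
    envelopeLift f hf (toEnvelope b) = f b :=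
  completionLift_coe (A := EnvelopePre B) f _ b

theorem norm_toEnvelope_le (b : B) : ‖toEnvelope b‖ ≤ ‖b‖ := by
  rw [toEnvelope, Completion.norm_coe]
  exact maxCStarSeminorm_le fun p => p.le_norm' b

variable (B) in
/-- `toEnvelope` as a continuous linear map. -/
def toEnvelopeL : B →L[ℂ] EnvelopingCStar B :=
  LinearMap.mkContinuous
    { toFun := toEnvelope
      map_add' := Completion.coe_add (α := EnvelopePre B)
      map_smul' := (Completion.toComplₗᵢ (𝕜 := ℂ) (E := EnvelopePre B)).map_smul }
    1 fun b => (norm_toEnvelope_le b).trans_eq (one_mul _).symm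

theorem denseRange_toEnvelopeL : DenseRange (toEnvelopeL B) :=
  Completion.denseRange_coe (α := EnvelopePre B)

end EnvelopeLift

section WeylSystem

variable {G : Type u} [AddCommGroup G] {σ : PresymplecticForm G} {C : Type v} [CStarAlgebra C]
  {W : G → C}

/-- A representation of the Weyl relations in a C*-algebra. These are the data from which
`*`-homomorphisms out of `𝒲(G)` are built. -/
structure IsWeylSystem (σ : PresymplecticForm G) (W : G → C) : Prop where
  map_zero : W 0 = 1
  map_mul : ∀ x y, W x * W y = σ.phase x y • W (x + y)
  map_star : ∀ x, star (W x) = W (-x)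

theorem isWeylSystem_weyl (σ : PresymplecticForm G) : IsWeylSystem σ (weyl σ) :=
  ⟨weyl_zero σ, weyl_mul σ, weyl_star σ⟩

theorem dense_span_range_weyl (σ : PresymplecticForm G) :
    Dense (Submodule.span ℂ (Set.range (weyl σ)) : Set (WeylAlgebra σ)) := by
  have hdense : DenseRange fun a : WeylPre σ => toEnvelopeL (WeylBanach σ) a :=
    denseRange_toEnvelopeL.comp UniformSpace.Completion.denseRange_coe
      (toEnvelopeL (WeylBanach σ)).continuous
  refine Dense.mono ?_ hdense
  rintro _ ⟨a, rfl⟩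
  rw [SetLike.mem_coe]
  induction a using WeylPre.induction with
  | zero => simp only [UniformSpace.Completion.coe_zero, map_zero, Submodule.zero_mem]
  | add a b ha hb =>
    simpa only [UniformSpace.Completion.coe_add, map_add] using Submodule.add_mem _ ha hb
  | single x α =>
    have hsingle : (WeylPre.single x α : WeylPre σ) = α • WeylPre.single x 1 := by
      rw [WeylPre.smul_single, mul_one]
    simp only [hsingle, UniformSpace.Completion.coe_smul, map_smul]
    exact Submodule.smul_mem _ α (Submodule.subset_span (Set.mem_range_self x))

theorem weylAlgebra_clm_ext {E : Type w} [TopologicalSpace E] [T2Space E] [AddCommGroup E]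
    [Module ℂ E] {f g : WeylAlgebra σ →L[ℂ] E} (h : ∀ x, f (weyl σ x) = g (weyl σ x)) : f = g :=
  ContinuousLinearMap.ext_on (dense_span_range_weyl σ) (Set.forall_mem_range.mpr h)

/-- A `*`-homomorphism out of `𝒲(G)` as a continuous linear map. -/
def weylHomL (f : WeylAlgebra σ →⋆ₐ[ℂ] C) : WeylAlgebra σ →L[ℂ] C :=
  LinearMap.mkContinuous (f : WeylAlgebra σ →ₗ[ℂ] C) 1 fun a =>
    (NonUnitalStarAlgHom.norm_apply_le f a).trans_eq (one_mul _).symm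

theorem weylAlgebra_hom_ext {f g : WeylAlgebra σ →⋆ₐ[ℂ] C}
    (h : ∀ x, f (weyl σ x) = g (weyl σ x)) : f = g := by
  have hL : weylHomL f = weylHomL g := weylAlgebra_clm_ext h
  exact StarAlgHom.ext fun a => congrArg (fun F : WeylAlgebra σ →L[ℂ] C => F a) hL

/-- The linear map on `𝒜(G)` with prescribed values on the generators; for a Weyl system it is a
`*`-homomorphism. -/
def WeylPre.linearExtension {E : Type w} [AddCommGroup E] [Module ℂ E] (σ : PresymplecticForm G)
    (W : G → E) : WeylPre σ →ₗ[ℂ] E :=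
  Finsupp.linearCombination ℂ W

theorem WeylPre.linearExtension_single {E : Type w} [AddCommGroup E] [Module ℂ E]
    (W : G → E) (x : G) (α : ℂ) :
    WeylPre.linearExtension σ W (WeylPre.single x α) = α • W x :=
  Finsupp.linearCombination_single ℂ α x

namespace IsWeylSystem

theorem norm_le_one (hW : IsWeylSystem σ W) (x : G) : ‖W x‖ ≤ 1 := by
  rcases subsingleton_or_nontrivial C with hC | hC
  · simp [Subsingleton.elim (W x) 0]
  · have hsq : ‖W x‖ * ‖W x‖ = 1 := by
      rw [← CStarRing.norm_star_mul_self, hW.map_star, hW.map_mul, neg_add_cancel, hW.map_zero,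
        norm_smul, σ.norm_phase, CStarRing.norm_one, one_mul]
    nlinarith

/-- The `*`-homomorphism `𝒜(G) → C` defined by a Weyl system in `C`. -/
def preHom (hW : IsWeylSystem σ W) : WeylPre σ →⋆ₐ[ℂ] C where
  __ := AlgHom.ofLinearMap (WeylPre.linearExtension σ W)
    (by rw [WeylPre.one_def, WeylPre.linearExtension_single, hW.map_zero, one_smul])
    (fun a b => by
      induction a using WeylPre.induction with
      | zero => simp only [zero_mul, _root_.map_zero]
      | add a a' h h' => rw [add_mul, map_add, h, h', map_add, add_mul]
      | single x α =>
        induction b using WeylPre.induction with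
        | zero => simp only [mul_zero, _root_.map_zero]
        | add b b' h h' => rw [mul_add, map_add, h, h', map_add, mul_add]
        | single y β =>
          simp only [WeylPre.single_mul_single, WeylPre.linearExtension_single]
          rw [smul_mul_smul_comm, hW.map_mul, smul_smul])
  map_star' a := by
    change WeylPre.linearExtension σ W (star a) = star (WeylPre.linearExtension σ W a)
    induction a using WeylPre.induction with
    | zero => simp only [star_zero, _root_.map_zero]
    | add a a' h h' => rw [star_add, map_add, h, h', map_add, star_add]
    | single x α =>
      simp only [WeylPre.star_single, WeylPre.linearExtension_single, star_smul, hW.map_star]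

theorem preHom_single (hW : IsWeylSystem σ W) (x : G) (α : ℂ) :
    hW.preHom (WeylPre.single x α) = α • W x :=
  WeylPre.linearExtension_single W x α

theorem norm_preHom_le (hW : IsWeylSystem σ W) (a : WeylPre σ) : ‖hW.preHom a‖ ≤ ‖a‖ := by
  nth_rw 1 [a.eq_sum_single]
  rw [map_sum]
  refine (norm_sum_le _ _).trans (Finset.sum_le_sum fun x _ => ?_)
  rw [preHom_single, norm_smul]
  exact mul_le_of_le_one_right (norm_nonneg _) (hW.norm_le_one x)

/-- The `*`-homomorphism `𝒲(G) → C` defined by a Weyl system in `C`. -/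
def lift (hW : IsWeylSystem σ W) : WeylAlgebra σ →⋆ₐ[ℂ] C :=
  envelopeLift (completionLift hW.preHom hW.norm_preHom_le) (norm_completionLift_le _ _)

theorem lift_weyl (hW : IsWeylSystem σ W) (x : G) : hW.lift (weyl σ x) = W x := by
  rw [lift, weyl, envelopeLift_toEnvelope, completionLift_coe, preHom_single, one_smul]

theorem existsUnique_hom (hW : IsWeylSystem σ W) :
    ∃! f : WeylAlgebra σ →⋆ₐ[ℂ] C, ∀ x, f (weyl σ x) = W x :=
  ⟨hW.lift, hW.lift_weyl, fun _ hf =>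
    weylAlgebra_hom_ext fun x => (hf x).trans (hW.lift_weyl x).symm⟩

theorem comp {H : Type w} [AddCommGroup H] {τ : PresymplecticForm H} {V : H → C}
    (hV : IsWeylSystem τ V) {ζ : G →+ H} (hζ : ∀ x y, τ.toHom (ζ x) (ζ y) = σ.toHom x y) :
    IsWeylSystem σ (V ∘ ζ) where
  map_zero := by rw [Function.comp_apply, _root_.map_zero, hV.map_zero]
  map_mul x y := by
    simp only [Function.comp_apply, hV.map_mul, map_add, PresymplecticForm.phase, hζ]
  map_star x := by simp only [Function.comp_apply, hV.map_star, map_neg]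

end IsWeylSystem

end WeylSystem

/-! ### The regular representation and the canonical trace -/

section Regular

open scoped InnerProductSpace

variable (G : Type u)

/-- The Hilbert space `ℓ²(G)` carrying the regular representation of `𝒲(G)`. -/
abbrev EllTwo : Type u := lp (fun _ : G => ℂ) 2

/-- The standard orthonormal basis `(δ_x)` of `ℓ²(G)`. -/
def deltaBasis : HilbertBasis G ℂ (EllTwo G) := .ofRepr (LinearIsometryEquiv.refl ℂ _)

variable {G}

theorem inner_deltaBasis (x : G) (f : EllTwo G) : ⟪deltaBasis G x, f⟫_ℂ = f x :=
  ((deltaBasis G).repr_apply_apply f x).symm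

open Classical in
theorem deltaBasis_apply (x y : G) : deltaBasis G x y = if y = x then 1 else 0 :=
  (inner_deltaBasis y _).symm.trans
    (orthonormal_iff_ite.mp (deltaBasis G).orthonormal y x)

variable [AddCommGroup G] (σ : PresymplecticForm G)

/-- The operator `(W(x) f)(y) = exp(2πi σ(x, y)) f(y - x)` on `ℓ²(G)`. -/
def regular (x : G) : EllTwo G →ₗᵢ[ℂ] EllTwo G where
  toFun f := ⟨fun y => σ.phase x y * f (y - x), memℓp_gen <| by
    simpa [Function.comp_def] using
      (Equiv.subRight x).summable_iff.mpr ((lp.memℓp f).summable (by norm_num))⟩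
  map_add' _ _ := lp.ext <| funext fun _ => mul_add _ _ _
  map_smul' _ _ := lp.ext <| funext fun _ => mul_left_comm _ _ _
  norm_map' f := by
    rw [lp.norm_eq_tsum_rpow (by norm_num), lp.norm_eq_tsum_rpow (by norm_num),
      ← (Equiv.subRight x).tsum_eq fun y => ‖f y‖ ^ (2 : ENNReal).toReal]
    simp

theorem regular_apply (x : G) (f : EllTwo G) (y : G) :
    regular σ x f y = σ.phase x y * f (y - x) := rfl

variable {σ}

/-- The condition `σ(x, x) = 0`, which antisymmetry gives only up to `2`-torsion. Without it the
relations `W(x)* = W(-x)` and `W(x) W(-x) = exp(-2πi σ(x, x))` force `𝒲(G) = 0`. -/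
def PresymplecticForm.IsAlternating (σ : PresymplecticForm G) : Prop := ∀ x, σ.toHom x x = 0

theorem PresymplecticForm.IsAlternating.phase_self (hσ : σ.IsAlternating) (x : G) :
    σ.phase x x = 1 := by
  simp [PresymplecticForm.phase, hσ x]

theorem PresymplecticForm.phase_neg_right (σ : PresymplecticForm G) (x y : G) :
    σ.phase x (-y) = σ.phase y x := by
  rw [PresymplecticForm.phase, PresymplecticForm.phase, map_neg, ← σ.antisymm]

theorem regular_zero (f : EllTwo G) : regular σ 0 f = f := by
  ext y
  simp [regular_apply]

theorem regular_regular (x y : G) (f : EllTwo G) :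
    regular σ x (regular σ y f) = σ.phase x y • regular σ (x + y) f := by
  ext z
  change σ.phase x z * (σ.phase y (z - x) * f (z - x - y)) =
    σ.phase x y * (σ.phase (x + y) z * f (z - (x + y)))
  rw [sub_eq_add_neg z x, σ.phase_add_right, σ.phase_neg_right, σ.phase_add_left, ← sub_eq_add_neg,
    sub_sub]
  ring

theorem regular_deltaBasis_zero (hσ : σ.IsAlternating) (x : G) :
    regular σ x (deltaBasis G 0) = deltaBasis G x := by
  ext y
  rw [regular_apply, deltaBasis_apply, deltaBasis_apply]
  rcases eq_or_ne y x with rfl | h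
  · rw [sub_self, if_pos rfl, if_pos rfl, hσ.phase_self, mul_one]
  · rw [if_neg (sub_ne_zero.mpr h), if_neg h, mul_zero]

theorem isWeylSystem_regular (hσ : σ.IsAlternating) :
    IsWeylSystem σ fun x => (regular σ x).toContinuousLinearMap where
  map_zero := ContinuousLinearMap.ext regular_zero
  map_mul x y := ContinuousLinearMap.ext (regular_regular x y)
  map_star x := by
    have hright : (regular σ x).toContinuousLinearMap * (regular σ (-x)).toContinuousLinearMap =
        1 := by
      ext1 f
      change regular σ x (regular σ (-x) f) = f
      rw [regular_regular, add_neg_cancel, regular_zero, σ.phase_neg_right, hσ.phase_self, one_smul]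
    have hleft : star (regular σ x).toContinuousLinearMap *
        (regular σ x).toContinuousLinearMap = 1 := by
      rw [ContinuousLinearMap.star_eq_adjoint]
      exact (regular σ x).adjoint_comp_self
    exact left_inv_eq_right_inv hleft hright

/-- The regular representation of `𝒲(G)` on `ℓ²(G)`. -/
def regularRep (hσ : σ.IsAlternating) : WeylAlgebra σ →⋆ₐ[ℂ] (EllTwo G →L[ℂ] EllTwo G) :=
  (isWeylSystem_regular hσ).lift

theorem regularRep_weyl (hσ : σ.IsAlternating) (x : G) :
    regularRep hσ (weyl σ x) = (regular σ x).toContinuousLinearMap :=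
  (isWeylSystem_regular hσ).lift_weyl x

theorem regularRep_weyl_deltaBasis_zero (hσ : σ.IsAlternating) (x : G) :
    regularRep hσ (weyl σ x) (deltaBasis G 0) = deltaBasis G x := by
  rw [regularRep_weyl]
  exact regular_deltaBasis_zero hσ x

theorem linearIndependent_regularRep_weyl (hσ : σ.IsAlternating) :
    LinearIndependent ℂ (regularRep hσ ∘ weyl σ) := by
  have hδ : (fun x => regularRep hσ (weyl σ x) (deltaBasis G 0)) = deltaBasis G :=
    funext (regularRep_weyl_deltaBasis_zero hσ)
  refine .of_comp (ContinuousLinearMap.apply ℂ (EllTwo G) (deltaBasis G 0)).toLinearMap ?_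
  change LinearIndependent ℂ fun x => regularRep hσ (weyl σ x) (deltaBasis G 0)
  rw [hδ]
  exact (deltaBasis G).orthonormal.linearIndependent

end Regular

section Isometry

variable {G : Type u} [AddCommGroup G] {σ : PresymplecticForm G}

theorem IsWeylSystem.norm_map_preHom [Finite G] {C : Type v} {D : Type w} [CStarAlgebra C]
    [CStarAlgebra D] {W : G → C} (hW : IsWeylSystem σ W) (φ : C →⋆ₐ[ℂ] D)
    (hφ : LinearIndependent ℂ (φ ∘ W)) (a : WeylPre σ) : ‖φ (hW.preHom a)‖ = ‖hW.preHom a‖ := by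
  let S : StarSubalgebra ℂ C := hW.preHom.range
  have : Module.Finite ℂ (WeylPre σ) := inferInstanceAs (Module.Finite ℂ (G →₀ ℂ))
  have : FiniteDimensional ℂ S.toSubalgebra.toSubmodule :=
    LinearMap.finiteDimensional_range (hW.preHom : WeylPre σ →ₗ[ℂ] C)
  have : IsClosed (S : Set C) := S.toSubalgebra.toSubmodule.closed_of_finiteDimensional
  have hinj : Function.Injective (φ.comp S.subtype) := by
    rw [injective_iff_map_eq_zero]
    rintro ⟨_, b, rfl⟩ hb
    have hsum : Finsupp.linearCombination ℂ (φ ∘ W) (b.coeff) = 0 :=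
      (Finsupp.apply_linearCombination ℂ (φ : C →ₗ[ℂ] D) W b.coeff).symm.trans hb
    have hb0 : b = 0 := linearIndependent_iff.mp hφ b.coeff hsum
    exact Subtype.ext ((congrArg hW.preHom hb0).trans (_root_.map_zero hW.preHom))
  exact NonUnitalStarAlgHom.norm_map (φ.comp S.subtype) hinj ⟨_, a, rfl⟩

theorem norm_regularRep_of_mem_span (hG : IsAddTorsion G) (hσ : σ.IsAlternating)
    {a : WeylAlgebra σ} (ha : a ∈ Submodule.span ℂ (Set.range (weyl σ))) :
    ‖regularRep hσ a‖ = ‖a‖ := by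
  obtain ⟨c, rfl⟩ := Finsupp.mem_span_range_iff_exists_finsupp.mp ha
  let F : AddSubgroup G := AddSubgroup.closure c.support
  have : Finite F := AddCommGroup.finite_of_fg_isAddTorsion _ (hG.addSubgroup F)
  have hW : IsWeylSystem (σ.pullback F.subtype) (weyl σ ∘ F.subtype) :=
    (isWeylSystem_weyl σ).comp fun _ _ => rfl
  have hmem : (c.sum fun x α => α • weyl σ x) ∈ hW.preHom.range := by
    refine sum_mem fun x hx => ⟨WeylPre.single ⟨x, AddSubgroup.subset_closure hx⟩ (c x), ?_⟩
    exact hW.preHom_single _ _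
  obtain ⟨b, hb⟩ := hmem
  rw [← hb]
  exact hW.norm_map_preHom (regularRep hσ)
    ((linearIndependent_regularRep_weyl hσ).comp _ Subtype.val_injective) b

theorem norm_regularRep (hG : IsAddTorsion G) (hσ : σ.IsAlternating) (a : WeylAlgebra σ) :
    ‖regularRep hσ a‖ = ‖a‖ :=
  (dense_span_range_weyl σ).induction (fun _ => norm_regularRep_of_mem_span hG hσ)
    (isClosed_eq (weylHomL (regularRep hσ)).continuous.norm continuous_norm) a

end Isometry

section Trace

open scoped InnerProductSpace

variable {G : Type u} [AddCommGroup G] {σ : PresymplecticForm G}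

/-- `φ` is the canonical trace on `𝒲(G)`: it sends `W(0)` to `1` and all other generators to `0`.
The functional `ω_tor` is the case of the torsion topological sector. -/
def IsCanonicalTrace (φ : WeylAlgebra σ →L[ℂ] ℂ) : Prop :=
  φ (weyl σ 0) = 1 ∧ ∀ x, x ≠ 0 → φ (weyl σ x) = 0

theorem IsCanonicalTrace.eq {φ ψ : WeylAlgebra σ →L[ℂ] ℂ} (hφ : IsCanonicalTrace φ)
    (hψ : IsCanonicalTrace ψ) : φ = ψ := by
  refine weylAlgebra_clm_ext fun x => ?_
  rcases eq_or_ne x 0 with rfl | hx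
  · rw [hφ.1, hψ.1]
  · rw [hφ.2 x hx, hψ.2 x hx]

theorem IsCanonicalTrace.mul_weyl {φ : WeylAlgebra σ →L[ℂ] ℂ} (hφ : IsCanonicalTrace φ)
    (a : WeylAlgebra σ) (x : G) : φ (a * weyl σ x) = φ (weyl σ x * a) := by
  have hcomp : φ.comp ((ContinuousLinearMap.mul ℂ (WeylAlgebra σ)).flip (weyl σ x)) =
      φ.comp (ContinuousLinearMap.mul ℂ (WeylAlgebra σ) (weyl σ x)) := by
    refine weylAlgebra_clm_ext fun y => ?_
    simp only [ContinuousLinearMap.comp_apply, ContinuousLinearMap.flip_apply,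
      ContinuousLinearMap.mul_apply', weyl_mul, map_smul, add_comm x y]
    rcases eq_or_ne (y + x) 0 with h | h
    · rw [eq_neg_of_add_eq_zero_left h, σ.phase_neg_right, ← σ.phase_neg_right, neg_neg]
    · rw [hφ.2 _ h, smul_zero, smul_zero]
  exact DFunLike.congr_fun hcomp a

theorem IsCanonicalTrace.comp {H : Type v} [AddCommGroup H] {τ : PresymplecticForm H} {ζ : G →+ H}
    (hζ : Function.Injective ζ) {Z : WeylAlgebra σ →⋆ₐ[ℂ] WeylAlgebra τ}
    (hZ : ∀ x, Z (weyl σ x) = weyl τ (ζ x)) {ψ : WeylAlgebra τ →L[ℂ] ℂ}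
    (hψ : IsCanonicalTrace ψ) :
    IsCanonicalTrace (ψ.comp (weylHomL Z)) := by
  refine ⟨?_, fun x hx => ?_⟩
  · exact (congrArg ψ (hZ 0)).trans (by rw [map_zero, hψ.1])
  · exact (congrArg ψ (hZ x)).trans (hψ.2 _ ((map_ne_zero_iff ζ hζ).mpr hx))

/-- The vector state `a ↦ ⟨δ₀, a δ₀⟩` of the regular representation, which realizes the canonical
trace. -/
def weylTrace (hσ : σ.IsAlternating) : WeylAlgebra σ →L[ℂ] ℂ :=
  (innerSL ℂ (deltaBasis G 0)).comp <|
    (ContinuousLinearMap.apply ℂ (EllTwo G) (deltaBasis G 0)).comp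
      (weylHomL (regularRep hσ))

theorem weylTrace_apply (hσ : σ.IsAlternating) (a : WeylAlgebra σ) :
    weylTrace hσ a = ⟪deltaBasis G 0, regularRep hσ a (deltaBasis G 0)⟫_ℂ := rfl

theorem weylTrace_star_mul_self (hσ : σ.IsAlternating) (a : WeylAlgebra σ) :
    weylTrace hσ (star a * a) = (‖regularRep hσ a (deltaBasis G 0)‖ : ℂ) ^ 2 := by
  rw [weylTrace_apply, map_mul, map_star, ContinuousLinearMap.star_eq_adjoint,
    mul_apply_eq_comp, ContinuousLinearMap.adjoint_inner_right]
  exact inner_self_eq_norm_sq_to_K _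

theorem isCanonicalTrace_weylTrace (hσ : σ.IsAlternating) : IsCanonicalTrace (weylTrace hσ) := by
  constructor
  · rw [weylTrace_apply, regularRep_weyl_deltaBasis_zero, inner_deltaBasis, deltaBasis_apply,
      if_pos rfl]
  · intro x hx
    rw [weylTrace_apply, regularRep_weyl_deltaBasis_zero, inner_deltaBasis, deltaBasis_apply,
      if_neg hx.symm]

theorem existsUnique_isCanonicalTrace (hσ : σ.IsAlternating) :
    ∃! φ : WeylAlgebra σ →L[ℂ] ℂ, IsCanonicalTrace φ :=
  ⟨weylTrace hσ, isCanonicalTrace_weylTrace hσ, fun _ hφ =>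
    hφ.eq (isCanonicalTrace_weylTrace hσ)⟩

theorem IsCanonicalTrace.isState (hσ : σ.IsAlternating) {φ : WeylAlgebra σ →L[ℂ] ℂ}
    (hφ : IsCanonicalTrace φ) : IsState φ := by
  refine ⟨hφ.1, fun a => ?_⟩
  rw [hφ.eq (isCanonicalTrace_weylTrace hσ), weylTrace_star_mul_self]
  exact_mod_cast sq_nonneg ‖regularRep hσ a (deltaBasis G 0)‖

theorem norm_regularRep_deltaBasis (hσ : σ.IsAlternating) (a : WeylAlgebra σ) (x : G) :
    ‖regularRep hσ a (deltaBasis G x)‖ = ‖regularRep hσ a (deltaBasis G 0)‖ := by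
  have hunit : weyl σ x * star (weyl σ x) = 1 := by
    rw [weyl_star, weyl_mul, add_neg_cancel, σ.phase_neg_right, hσ.phase_self, one_smul, weyl_zero]
  have htrace : weylTrace hσ (star (a * weyl σ x) * (a * weyl σ x)) =
      weylTrace hσ (star a * a) := by
    rw [star_mul, ← mul_assoc, (isCanonicalTrace_weylTrace hσ).mul_weyl, mul_assoc, ← mul_assoc,
      ← mul_assoc, hunit, one_mul]
  rw [weylTrace_star_mul_self, weylTrace_star_mul_self, map_mul, mul_apply_eq_comp,
    regularRep_weyl_deltaBasis_zero] at htrace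
  exact (pow_left_inj₀ (norm_nonneg _) (norm_nonneg _) two_ne_zero).mp (by exact_mod_cast htrace)

theorem IsCanonicalTrace.isFaithful (hG : IsAddTorsion G) (hσ : σ.IsAlternating)
    {φ : WeylAlgebra σ →L[ℂ] ℂ} (hφ : IsCanonicalTrace φ) : IsFaithful φ := by
  intro a ha
  rw [hφ.eq (isCanonicalTrace_weylTrace hσ), weylTrace_star_mul_self] at ha
  have hδ (x : G) : regularRep hσ a (deltaBasis G x) = 0 := by
    rw [← norm_eq_zero, norm_regularRep_deltaBasis]
    exact_mod_cast pow_eq_zero_iff two_ne_zero |>.mp ha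
  have hzero : regularRep hσ a = 0 :=
    ContinuousLinearMap.ext_on
      (Submodule.dense_iff_topologicalClosure_eq_top.mpr (deltaBasis G).dense_span)
      (Set.forall_mem_range.mpr hδ)
  rw [← norm_eq_zero, ← norm_regularRep hG hσ, hzero, norm_zero]

end Trace

/-! ### Graded commutativity of the cup product -/

section VertexChains

variable {V : Type u} {W : Type v}

/-- Integral combinations of the ordered simplices `(g 0, …, g m)` with vertices in `V`, degenerate
ones included. For `V = Fin (n + 1)` they encode the natural operations from `m`-cochains to
`n`-cochains built from affine maps of simplices. -/
abbrev VertexChain (V : Type u) (m : ℕ) : Type u := (Fin (m + 1) → V) →₀ ℤ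

namespace VertexChain

/-- The simplicial boundary of vertex chains. -/
def boundary (m : ℕ) : VertexChain V (m + 1) →+ VertexChain V m :=
  ∑ i : Fin (m + 2), (-1 : ℤ) ^ (i : ℕ) • Finsupp.mapDomain.addMonoidHom fun g => g ∘ i.succAbove

/-- The chain map induced by a map of vertices. -/
def map (φ : V → W) (m : ℕ) : VertexChain V m →+ VertexChain W m :=
  Finsupp.mapDomain.addMonoidHom fun g => φ ∘ g

/-- Precomposition of the simplices with a map of their index sets. -/
def comap {m n : ℕ} (g : Fin (m + 1) → Fin (n + 1)) : VertexChain V n →+ VertexChain V m :=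
  Finsupp.mapDomain.addMonoidHom fun f => f ∘ g

/-- The cone with apex `v`, a contracting homotopy of the vertex chains. -/
def cone (v : V) (m : ℕ) : VertexChain V m →+ VertexChain V (m + 1) :=
  Finsupp.mapDomain.addMonoidHom fun g => Fin.cons v g

/-- The alternating sum of the face inclusions of the standard `(n + 1)`-simplex; as an operation on
cochains it is composition with the coboundary. -/
def coface (n m : ℕ) : VertexChain (Fin (n + 1)) m →+ VertexChain (Fin (n + 2)) m :=
  ∑ i : Fin (n + 2), (-1 : ℤ) ^ (i : ℕ) • map i.succAbove m

theorem boundary_single (m : ℕ) (g : Fin (m + 2) → V) (a : ℤ) :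
    boundary m (Finsupp.single g a) =
      ∑ i : Fin (m + 2), (-1 : ℤ) ^ (i : ℕ) • Finsupp.single (g ∘ i.succAbove) a := by
  simp [boundary]

theorem map_single (φ : V → W) (m : ℕ) (g : Fin (m + 1) → V) (a : ℤ) :
    map φ m (Finsupp.single g a) = Finsupp.single (φ ∘ g) a :=
  Finsupp.mapDomain_single

theorem comap_single {m n : ℕ} (g : Fin (m + 1) → Fin (n + 1)) (f : Fin (n + 1) → V) (a : ℤ) :
    comap g (Finsupp.single f a) = Finsupp.single (f ∘ g) a :=
  Finsupp.mapDomain_single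

theorem cone_single (v : V) (m : ℕ) (g : Fin (m + 1) → V) (a : ℤ) :
    cone v m (Finsupp.single g a) = Finsupp.single (Fin.cons v g) a :=
  Finsupp.mapDomain_single

theorem coface_apply (n m : ℕ) (c : VertexChain (Fin (n + 1)) m) :
    coface n m c = ∑ i : Fin (n + 2), (-1 : ℤ) ^ (i : ℕ) • map i.succAbove m c := by
  simp [coface]

theorem boundary_map (φ : V → W) (m : ℕ) (c : VertexChain V (m + 1)) :
    boundary m (map φ (m + 1) c) = map φ m (boundary m c) := by
  induction c using Finsupp.induction_linear with
  | zero => simp only [map_zero]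
  | add c d hc hd => simp only [map_add, hc, hd]
  | single g a =>
    simp only [map_single, boundary_single, map_sum, map_zsmul, Function.comp_assoc]

theorem map_comap (φ : V → W) {m n : ℕ} (g : Fin (m + 1) → Fin (n + 1)) (c : VertexChain V n) :
    map φ m (comap g c) = comap g (map φ n c) := by
  induction c using Finsupp.induction_linear with
  | zero => simp only [map_zero]
  | add c d hc hd => simp only [map_add, hc, hd]
  | single f a => simp only [map_single, comap_single, Function.comp_assoc]

theorem boundary_coface (n m : ℕ) (c : VertexChain (Fin (n + 1)) (m + 1)) :
    boundary m (coface n (m + 1) c) = coface n m (boundary m c) := by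
  simp only [coface_apply, map_sum, map_zsmul, boundary_map]

theorem coface_comap {m n p : ℕ} (g : Fin (m + 1) → Fin (p + 1)) (c : VertexChain (Fin (n + 1)) p) :
    coface n m (comap g c) = comap g (coface n p c) := by
  simp only [coface_apply, map_sum, map_zsmul, map_comap]

theorem cons_comp_succAbove_zero (v : V) {m : ℕ} (g : Fin (m + 1) → V) :
    (Fin.cons v g : Fin (m + 2) → V) ∘ Fin.succAbove 0 = g := by
  ext k
  simp

theorem cons_comp_succAbove_succ (v : V) {m : ℕ} (g : Fin (m + 2) → V) (i : Fin (m + 2)) :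
    (Fin.cons v g : Fin (m + 3) → V) ∘ i.succ.succAbove = Fin.cons v (g ∘ i.succAbove) := by
  ext k
  cases k using Fin.cases <;> simp

theorem boundary_cone (v : V) (m : ℕ) (c : VertexChain V (m + 1)) :
    boundary (m + 1) (cone v (m + 1) c) = c - cone v m (boundary m c) := by
  induction c using Finsupp.induction_linear with
  | zero => simp only [map_zero, sub_zero]
  | add c d hc hd =>
    simp only [map_add, hc, hd]
    abel
  | single g a =>
    rw [cone_single, boundary_single, Fin.sum_univ_succ]
    simp only [cons_comp_succAbove_zero, cons_comp_succAbove_succ, boundary_single, cone_single,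
      map_sum, map_zsmul, Fin.val_zero, Fin.val_succ, pow_zero, one_smul, pow_succ, mul_neg,
      mul_one, neg_smul, Finset.sum_neg_distrib, sub_eq_add_neg]

theorem boundary_cone_zero (v : V) (g : Fin 1 → V) (a : ℤ) :
    boundary 0 (cone v 0 (Finsupp.single g a)) =
      Finsupp.single g a - Finsupp.single (fun _ => v) a := by
  have hlast : (Fin.cons v g : Fin 2 → V) ∘ Fin.succAbove 1 = fun _ => v := by
    ext k
    simp [Subsingleton.elim k 0]
  rw [cone_single, boundary_single, Fin.sum_univ_two, cons_comp_succAbove_zero, hlast]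
  simp [sub_eq_add_neg]

theorem single_eq_cone (m : ℕ) (g : Fin (m + 2) → V) (a : ℤ) :
    Finsupp.single g a = cone (g 0) m (Finsupp.single (Fin.tail g) a) := by
  rw [cone_single, Fin.cons_self_tail]

theorem boundary_boundary (m : ℕ) (c : VertexChain V (m + 2)) :
    boundary m (boundary (m + 1) c) = 0 := by
  induction m with
  | zero =>
    induction c using Finsupp.induction_linear with
    | zero => simp only [map_zero]
    | add c d hc hd => simp only [map_add, hc, hd, add_zero]
    | single g a =>
      rw [single_eq_cone, boundary_cone, map_sub, boundary_single, Fin.sum_univ_two]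
      simp only [map_add, map_neg, boundary_cone_zero, Fin.val_zero, Fin.val_one, pow_zero,
        pow_one, one_smul, neg_smul]
      abel
  | succ m ih =>
    induction c using Finsupp.induction_linear with
    | zero => simp only [map_zero]
    | add c d hc hd => simp only [map_add, hc, hd, add_zero]
    | single g a =>
      rw [single_eq_cone, boundary_cone, map_sub, boundary_cone, ih, map_zero, sub_zero, sub_self]

/-- The standard `n`-simplex; as an operation on cochains it is the identity. -/
def std (n : ℕ) : VertexChain (Fin (n + 1)) n := Finsupp.single id 1

theorem boundary_std (n : ℕ) : boundary n (std (n + 1)) = coface n n (std n) := by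
  simp [std, boundary_single, coface_apply, map_single]

theorem coface_coface (n m : ℕ) (c : VertexChain (Fin (n + 1)) m) :
    coface (n + 1) m (coface n m c) = 0 := by
  have hstd : coface (n + 1) n (coface n n (std n)) = 0 := by
    rw [← boundary_std, ← boundary_coface, ← boundary_std, boundary_boundary]
  induction c using Finsupp.induction_linear with
  | zero => simp only [map_zero]
  | add c d hc hd => simp only [map_add, hc, hd, add_zero]
  | single g a =>
    have hg : (Finsupp.single g a : VertexChain (Fin (n + 1)) m) = a • comap g (std n) := by
      simp [std, comap_single]
    rw [hg, map_zsmul, map_zsmul, coface_comap, coface_comap, hstd, map_zero, smul_zero]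

end VertexChain

/-- The sign `(-1)^{n(n+1)/2}` of the reversal of the vertices of an `n`-simplex. -/
def revSign : ℕ → ℤ
  | 0 => 1
  | n + 1 => (-1) ^ (n + 1) * revSign n

theorem revSign_succ (n : ℕ) : revSign (n + 1) = (-1) ^ (n + 1) * revSign n := rfl

theorem revSign_add (p q : ℕ) : revSign (p + q) = (-1) ^ (p * q) * (revSign p * revSign q) := by
  induction q with
  | zero => simp [revSign]
  | succ q ih =>
    rw [← add_assoc, revSign_succ, ih, revSign_succ]
    ring

theorem neg_one_pow_mul_self (n : ℕ) : (-1 : ℤ) ^ n * (-1) ^ n = 1 := by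
  rw [← mul_pow, neg_one_mul, neg_neg, one_pow]

theorem neg_one_pow_val_rev {n : ℕ} (i : Fin (n + 2)) :
    (-1 : ℤ) ^ (i.rev : ℕ) = (-1) ^ (n + 1) * (-1) ^ (i : ℕ) := by
  have hsum : (i.rev : ℕ) + i = n + 1 := by
    rw [Fin.val_rev]
    omega
  rw [← hsum, pow_add, mul_assoc, neg_one_pow_mul_self, mul_one]

namespace VertexChain

/-- The signed reversal of the standard `n`-simplex. -/
def rev (n : ℕ) : VertexChain (Fin (n + 1)) n := Finsupp.single Fin.rev (revSign n)

theorem succAbove_comp_rev {n : ℕ} (i : Fin (n + 2)) :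
    i.succAbove ∘ (Fin.rev : Fin (n + 1) → Fin (n + 1)) = Fin.rev ∘ i.rev.succAbove := by
  ext k
  simp [Fin.rev_succAbove]

theorem boundary_rev (n : ℕ) : boundary n (rev (n + 1)) = coface n n (rev n) := by
  rw [rev, rev, boundary_single, coface_apply, ← Equiv.sum_comp Fin.revPerm]
  refine Finset.sum_congr rfl fun i _ => ?_
  rw [Fin.revPerm_apply, neg_one_pow_val_rev, revSign_succ, map_single, succAbove_comp_rev,
    Finsupp.smul_single, Finsupp.smul_single, smul_eq_mul, smul_eq_mul, mul_right_comm,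
    ← mul_assoc, neg_one_pow_mul_self, one_mul, mul_comm]

/-- The natural chain homotopy from the identity to the signed reversal. Since the vertex chains on
`Fin (n + 2)` are contractible, it is constructed by acyclic models, the cone providing the
primitives. -/
def homotopy : (n : ℕ) → VertexChain (Fin (n + 1)) (n + 1)
  | 0 => 0
  | n + 1 => cone 0 (n + 1) (rev (n + 1) - std (n + 1) - coface n (n + 1) (homotopy n))

theorem rev_zero : rev 0 = std 0 :=
  congrArg (Finsupp.single · 1) (Subsingleton.elim (Fin.rev : Fin 1 → Fin 1) id)

theorem boundary_homotopy_zero : boundary 0 (homotopy 0) = rev 0 - std 0 := by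
  rw [homotopy, map_zero, rev_zero, sub_self]

theorem boundary_homotopy_succ (n : ℕ) : boundary (n + 1) (homotopy (n + 1)) =
    rev (n + 1) - std (n + 1) - coface n (n + 1) (homotopy n) := by
  have hcycle : boundary n (rev (n + 1) - std (n + 1) - coface n (n + 1) (homotopy n)) = 0 := by
    rw [map_sub, map_sub, boundary_rev, boundary_std, boundary_coface, ← map_sub, ← map_sub]
    cases n with
    | zero => rw [boundary_homotopy_zero, sub_self, map_zero]
    | succ n => rw [boundary_homotopy_succ n, sub_sub_cancel, coface_coface]
  rw [homotopy, boundary_cone, hcycle, map_zero, sub_zero]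

end VertexChain

end VertexChains

section Commutativity

open SingularSimplex

variable {X : Type u} [TopologicalSpace X] {A : Type v} [AddCommGroup A]

/-- The operation on cochains `f ↦ (s ↦ ∑ c_g f(s ∘ g))` encoded by a chain `c = ∑ c_g g` of the
standard simplex. -/
def Cochain.transform {n m : ℕ} (f : Cochain X A m) :
    VertexChain (Fin (n + 1)) m →+ Cochain X A n :=
  Finsupp.liftAddHom fun g => zmultiplesHom _ fun s => f (reindex g s)

namespace Cochain

variable {n m : ℕ}

theorem transform_single (f : Cochain X A m) (g : Fin (m + 1) → Fin (n + 1)) (a : ℤ) :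
    f.transform (Finsupp.single g a) = a • fun s => f (reindex g s) := by
  simp [transform]

theorem transform_zero (c : VertexChain (Fin (n + 1)) m) :
    (0 : Cochain X A m).transform c = 0 := by
  induction c using Finsupp.induction_linear with
  | zero => simp only [map_zero]
  | add c d hc hd => simp only [map_add, hc, hd, add_zero]
  | single g a =>
    rw [transform_single]
    exact smul_zero a

theorem transform_boundary (f : Cochain X A m) (c : VertexChain (Fin (n + 1)) (m + 1)) :
    f.transform (VertexChain.boundary m c) = (coboundary m f).transform c := by
  induction c using Finsupp.induction_linear with
  | zero => simp only [map_zero]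
  | add c d hc hd => simp only [map_add, hc, hd]
  | single g a =>
    ext s
    simp only [VertexChain.boundary_single, map_sum, map_zsmul, transform_single, Finset.sum_apply,
      Pi.smul_apply, coboundary_apply, face, reindex_reindex, Finset.smul_sum]
    simp only [smul_comm a]

theorem transform_coface (f : Cochain X A m) (c : VertexChain (Fin (n + 1)) m) :
    f.transform (VertexChain.coface n m c) = coboundary n (f.transform c) := by
  induction c using Finsupp.induction_linear with
  | zero => simp only [map_zero]
  | add c d hc hd => simp only [map_add, hc, hd]
  | single g a =>
    ext s
    simp only [VertexChain.coface_apply, VertexChain.map_single, map_sum, map_zsmul,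
      transform_single, Finset.sum_apply, Pi.smul_apply, coboundary_apply, face, reindex_reindex]

theorem transform_std (f : Cochain X A n) : f.transform (VertexChain.std n) = f := by
  ext s
  rw [VertexChain.std, transform_single, one_smul]
  congr 1
  ext x
  simp [reindex]

/-- The signed reversal of cochains, `(-1)^{n(n+1)/2}` times the reversal of the vertices. -/
def rev (f : Cochain X A n) : Cochain X A n := f.transform (VertexChain.rev n)

theorem rev_apply (f : Cochain X A n) (s : SingularSimplex X n) :
    f.rev s = revSign n • f (reindex Fin.rev s) :=
  congrFun (transform_single f Fin.rev (revSign n)) s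

theorem rev_sub_mem_coboundaries {f : Cochain X A n} (hf : f ∈ cocycles X A n) :
    f.rev - f ∈ coboundaries X A n := by
  have hboundary : f.transform (VertexChain.boundary n (VertexChain.homotopy n)) = 0 := by
    rw [transform_boundary, mem_cocycles.mp hf, transform_zero]
  cases n with
  | zero =>
    rw [VertexChain.boundary_homotopy_zero, map_sub, transform_std] at hboundary
    rw [rev, hboundary]
    exact zero_mem _
  | succ n =>
    refine ⟨f.transform (VertexChain.homotopy n), ?_⟩
    rw [VertexChain.boundary_homotopy_succ, map_sub, map_sub, transform_std, transform_coface,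
      sub_eq_zero] at hboundary
    exact hboundary.symm

theorem coboundaries_le_cocycles (n : ℕ) : coboundaries X A n ≤ cocycles X A n := by
  cases n with
  | zero => exact bot_le
  | succ n =>
    rintro _ ⟨e, rfl⟩
    exact coboundary_coboundary n e

theorem rev_mem_cocycles {f : Cochain X A n} (hf : f ∈ cocycles X A n) :
    f.rev ∈ cocycles X A n := by
  simpa only [sub_add_cancel] using
    add_mem (coboundaries_le_cocycles n (rev_sub_mem_coboundaries hf)) hf

end Cochain

section Faces

variable {p q n : ℕ} (s : SingularSimplex X (n + 1))

theorem front_face_of_lt (h : p ≤ n) {j : Fin (n + 2)} (hj : p < j) :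
    front h (face j s) = front (h.trans n.le_succ) s := by
  simp only [face, front, reindex_reindex]
  congr 1
  ext k
  simp only [Function.comp_apply, val_succAbove]
  split_ifs <;> omega

theorem back_face_of_le (h : p + q = n) {j : Fin (n + 2)} (hj : (j : ℕ) ≤ p) :
    back h (face j s) = back (by omega : p + 1 + q = n + 1) s := by
  simp only [face, back, reindex_reindex]
  congr 1
  ext k
  simp only [Function.comp_apply, val_succAbove]
  split_ifs <;> omega

theorem front_face_of_eq (h : p ≤ n) {j : Fin (n + 2)} {i : Fin (p + 2)} (hij : (j : ℕ) = i) :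
    front h (face j s) = face i (front (Nat.succ_le_succ h) s) := by
  simp only [face, front, reindex_reindex]
  congr 1
  ext k
  simp only [Function.comp_apply, val_succAbove, hij]

theorem back_face_of_eq (h : p + q = n) {j : Fin (n + 2)} {i : Fin (q + 2)}
    (hij : (j : ℕ) = p + i) :
    back h (face j s) = face i (back (by omega : p + (q + 1) = n + 1) s) := by
  simp only [face, back, reindex_reindex]
  congr 1
  ext k
  simp only [Function.comp_apply, val_succAbove, hij]
  split_ifs <;> omega

theorem face_last_front {s : SingularSimplex X n} (h : p + 1 ≤ n) :
    face (Fin.last (p + 1)) (front h s) = front (Nat.le_of_succ_le h) s := by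
  simp only [face, front, reindex_reindex]
  congr 1
  ext k
  simp

theorem face_zero_back {s : SingularSimplex X n} (h : p + (q + 1) = n) :
    face 0 (back h s) = back (by omega : p + 1 + q = n) s := by
  simp only [face, back, reindex_reindex]
  congr 1
  ext k
  simp only [Function.comp_apply, val_succAbove, Fin.val_zero, not_lt_zero, if_false]
  omega

theorem front_reindex_rev (h : q + p = n) (s : SingularSimplex X n) :
    front (by omega : p ≤ n) (reindex Fin.rev s) = reindex Fin.rev (back h s) := by
  simp only [front, back, reindex_reindex]
  congr 1
  ext k
  simp only [Function.comp_apply, Fin.val_rev]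
  omega

theorem back_reindex_rev (h : p + q = n) (s : SingularSimplex X n) :
    back h (reindex Fin.rev s) = reindex Fin.rev (front (by omega : q ≤ n) s) := by
  simp only [front, back, reindex_reindex]
  congr 1
  ext k
  simp only [Function.comp_apply, Fin.val_rev]
  omega

end Faces

variable {B : Type w} [AddCommGroup B] {C : Type*} [AddCommGroup C] {p q n : ℕ}

/-- The cup product of cochains with respect to a pairing `μ` of the coefficients. A general `μ`
is needed because graded commutativity replaces `μ` by `μ.flip`. -/
def cupWith (μ : A →+ B →+ C) (h : p + q = n) : Cochain X A p →+ Cochain X B q →+ Cochain X C n :=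
  AddMonoidHom.mk'
    (fun a => AddMonoidHom.mk' (fun b s => μ (a (front (Nat.le.intro h) s)) (b (back h s)))
      fun b b' => by ext s; simp)
    fun a a' => by ext b s; simp

theorem cupWith_apply (μ : A →+ B →+ C) (h : p + q = n) (a : Cochain X A p) (b : Cochain X B q)
    (s : SingularSimplex X n) :
    cupWith μ h a b s = μ (a (front (Nat.le.intro h) s)) (b (back h s)) := rfl

theorem coboundary_cupWith_apply (μ : A →+ B →+ C) (a : Cochain X A p) (b : Cochain X B q)
    (s : SingularSimplex X (p + q + 1)) :
    coboundary (p + q) (cupWith μ rfl a b) s =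
      ∑ i : Fin (p + 1), (-1 : ℤ) ^ (i : ℕ) •
          μ (a (face i.castSucc (front (by omega : p + 1 ≤ p + q + 1) s)))
            (b (back (by omega : p + 1 + q = p + q + 1) s)) +
        ∑ i : Fin (q + 1), (-1 : ℤ) ^ (p + (i + 1) : ℕ) •
          μ (a (front (by omega : p ≤ p + q + 1) s))
            (b (face i.succ (back (by omega : p + (q + 1) = p + q + 1) s))) := by
  have hn : (p + 1) + (q + 1) = p + q + 2 := by omega
  rw [coboundary_apply, ← (finCongr hn).sum_comp, Fin.sum_univ_add]
  congr 1 <;> refine Finset.sum_congr rfl fun i _ => ?_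
  · rw [cupWith_apply, front_face_of_eq (i := i.castSucc) s _ rfl,
      back_face_of_le s rfl (Nat.le_of_lt_succ i.2)]
    rfl
  · have hi : (finCongr hn (Fin.natAdd (p + 1) i) : ℕ) = p + (i + 1) := by
      simp only [finCongr_apply, Fin.val_cast, Fin.val_natAdd]
      omega
    rw [cupWith_apply, front_face_of_lt s _ (by omega), back_face_of_eq (i := i.succ) s rfl hi, hi]

theorem coboundary_cupWith (μ : A →+ B →+ C) (h : p + q = n) (a : Cochain X A p)
    (b : Cochain X B q) :
    coboundary n (cupWith μ h a b) =
      cupWith μ (by omega) (coboundary p a) b +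
        (-1 : ℤ) ^ p • cupWith μ (by omega) a (coboundary q b) := by
  subst h
  ext s
  have hp : p + 1 ≤ p + q + 1 := by omega
  have hq : p + (q + 1) = p + q + 1 := by omega
  have hpq : p + 1 + q = p + q + 1 := by omega
  have left_eq : coboundary p a (front hp s) =
      ∑ i : Fin (p + 1), (-1 : ℤ) ^ (i : ℕ) • a (face i.castSucc (front hp s)) +
        (-1 : ℤ) ^ (p + 1) • a (front (Nat.le_of_succ_le hp) s) := by
    rw [coboundary_apply, Fin.sum_univ_castSucc, face_last_front]
    rfl
  have right_eq : coboundary q b (back hq s) = b (back hpq s) +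
      ∑ i : Fin (q + 1), (-1 : ℤ) ^ (i + 1 : ℕ) • b (face i.succ (back hq s)) := by
    rw [coboundary_apply, Fin.sum_univ_succ, face_zero_back, Fin.val_zero, pow_zero, one_smul]
    rfl
  rw [Pi.add_apply, Pi.smul_apply, coboundary_cupWith_apply, cupWith_apply, cupWith_apply,
    left_eq, right_eq]
  simp only [map_add, map_sum, map_zsmul, AddMonoidHom.add_apply, AddMonoidHom.finsetSum_apply,
    AddMonoidHom.smul_apply, smul_add, Finset.smul_sum, smul_smul, ← pow_add]
  rw [pow_succ (-1 : ℤ) p, mul_neg_one, neg_smul]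
  abel

theorem cupWith_mem_coboundaries_left (μ : A →+ B →+ C) (h : p + q = n) {a : Cochain X A p}
    {b : Cochain X B q} (ha : a ∈ coboundaries X A p) (hb : b ∈ cocycles X B q) :
    cupWith μ h a b ∈ coboundaries X C n := by
  cases p with
  | zero =>
    obtain rfl : a = 0 := ha
    simp only [map_zero, AddMonoidHom.zero_apply, zero_mem]
  | succ p =>
    obtain ⟨e, rfl⟩ := ha
    obtain rfl : (p + q) + 1 = n := by omega
    refine ⟨cupWith μ rfl e b, ?_⟩
    rw [coboundary_cupWith, mem_cocycles.mp hb, map_zero, smul_zero, add_zero]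

theorem cupWith_mem_coboundaries_right (μ : A →+ B →+ C) (h : p + q = n) {a : Cochain X A p}
    {b : Cochain X B q} (ha : a ∈ cocycles X A p) (hb : b ∈ coboundaries X B q) :
    cupWith μ h a b ∈ coboundaries X C n := by
  cases q with
  | zero =>
    obtain rfl : b = 0 := hb
    simp only [map_zero, zero_mem]
  | succ q =>
    obtain ⟨e, rfl⟩ := hb
    obtain rfl : (p + q) + 1 = n := by omega
    refine ⟨(-1 : ℤ) ^ p • cupWith μ rfl a e, ?_⟩
    rw [map_zsmul, coboundary_cupWith, mem_cocycles.mp ha, map_zero, AddMonoidHom.zero_apply,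
      zero_add, smul_smul, neg_one_pow_mul_self, one_smul]

theorem cupWith_mem_cocycles (μ : A →+ B →+ C) (h : p + q = n) {a : Cochain X A p}
    {b : Cochain X B q} (ha : a ∈ cocycles X A p) (hb : b ∈ cocycles X B q) :
    cupWith μ h a b ∈ cocycles X C n := by
  rw [mem_cocycles, coboundary_cupWith, mem_cocycles.mp ha, mem_cocycles.mp hb, map_zero,
    map_zero, AddMonoidHom.zero_apply, smul_zero, add_zero]

theorem rev_cupWith (μ : A →+ B →+ C) (h : p + q = n) (h' : q + p = n) (a : Cochain X A p)
    (b : Cochain X B q) :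
    (cupWith μ h a b).rev = (-1 : ℤ) ^ (p * q) • cupWith μ.flip h' b.rev a.rev := by
  subst h
  ext s
  simp only [Cochain.rev_apply, cupWith_apply, Pi.smul_apply, front_reindex_rev h',
    back_reindex_rev, AddMonoidHom.flip_apply, map_zsmul, AddMonoidHom.smul_apply,
    smul_smul, revSign_add]

theorem cupWith_sub_flip_mem_coboundaries (μ : A →+ B →+ C) (h : p + q = n) (h' : q + p = n)
    {a : Cochain X A p} {b : Cochain X B q} (ha : a ∈ cocycles X A p) (hb : b ∈ cocycles X B q) :
    cupWith μ h a b - (-1 : ℤ) ^ (p * q) • cupWith μ.flip h' b a ∈ coboundaries X C n := by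
  have rev_sub_cup := Cochain.rev_sub_mem_coboundaries (cupWith_mem_cocycles μ h ha hb)
  have cup_rev_sub_rev := cupWith_mem_coboundaries_left μ.flip h'
    (Cochain.rev_sub_mem_coboundaries hb) (Cochain.rev_mem_cocycles ha)
  have cup_rev_sub := cupWith_mem_coboundaries_right μ.flip h' hb
    (Cochain.rev_sub_mem_coboundaries ha)
  rw [rev_cupWith μ h h'] at rev_sub_cup
  convert sub_mem (zsmul_mem (add_mem cup_rev_sub_rev cup_rev_sub) ((-1 : ℤ) ^ (p * q)))
    rev_sub_cup using 1
  simp only [map_sub, AddMonoidHom.sub_apply, smul_sub, smul_add]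
  abel

end Commutativity

/-! ### Symmetry of the torsion pairing and the duality -/

section Duality

variable {X : Type u} [TopologicalSpace X]

theorem cupWith_flip_smul {A : Type v} [AddCommGroup A] {p q n : ℕ} (h : p + q = n)
    (a : Cochain X A p) (b : Cochain X ℤ q) :
    cupWith (smulAddHom ℤ A).flip h a b = cochainCup h a b := rfl

theorem realToCircle_cupWith_left {p q n : ℕ} (h : p + q = n) (z : Cochain X ℤ p)
    (F : Cochain X ℝ q) :
    Cochain.realToCircle n (cupWith AddMonoidHom.mul h (Cochain.intToReal p z) F) =
      cupWith (smulAddHom ℤ UnitAddCircle) h z (Cochain.realToCircle q F) := by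
  ext s
  simp only [Cochain.mapCoeff, AddMonoidHom.coe_mk, ZeroHom.coe_mk, cupWith_apply,
    AddMonoidHom.mul_apply, smulAddHom_apply, ← map_zsmul, Int.coe_castAddHom, zsmul_eq_mul]

theorem realToCircle_cupWith_right {p q n : ℕ} (h : p + q = n) (F : Cochain X ℝ p)
    (z : Cochain X ℤ q) :
    Cochain.realToCircle n (cupWith AddMonoidHom.mul h F (Cochain.intToReal q z)) =
      cochainCup h (Cochain.realToCircle p F) z := by
  ext s
  simp only [Cochain.mapCoeff, AddMonoidHom.coe_mk, ZeroHom.coe_mk, cupWith_apply,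
    AddMonoidHom.mul_apply, cochainCup_apply, ← map_zsmul, Int.coe_castAddHom, zsmul_eq_mul,
    mul_comm]

theorem IsBockstein.cochainCup_sub_mem_coboundaries {p q : ℕ} {f : Cochain X UnitAddCircle p}
    {z : Cochain X ℤ (p + 1)} {f' : Cochain X UnitAddCircle q} {z' : Cochain X ℤ (q + 1)}
    (h : IsBockstein f z) (h' : IsBockstein f' z') (hf' : f' ∈ cocycles X UnitAddCircle q) :
    cochainCup (show p + (q + 1) = p + q + 1 by omega) f z' -
      (-1 : ℤ) ^ ((p + 1) * (q + 1)) • cochainCup (show q + (p + 1) = p + q + 1 by omega) f' z ∈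
        coboundaries X UnitAddCircle (p + q + 1) := by
  have commute := cupWith_sub_flip_mem_coboundaries (smulAddHom ℤ UnitAddCircle)
    (show (p + 1) + q = p + q + 1 by omega) (by omega) h.mem_cocycles hf'
  rw [cupWith_flip_smul] at commute
  obtain ⟨F, rfl, hF⟩ := h
  obtain ⟨F', rfl, hF'⟩ := h'
  -- `δ (F ∪ F') = z ∪ F' + (-1)^p F ∪ z'` for real lifts `F`, `F'` of `f`, `f'`
  have leibniz : coboundary (p + q)
      (Cochain.realToCircle (p + q) (cupWith AddMonoidHom.mul rfl F F')) ∈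
        coboundaries X UnitAddCircle (p + q + 1) := ⟨_, rfl⟩
  rw [Cochain.coboundary_mapCoeff, coboundary_cupWith, hF, hF', map_add, map_zsmul,
    realToCircle_cupWith_left, realToCircle_cupWith_right] at leibniz
  convert zsmul_mem (sub_mem leibniz commute) ((-1 : ℤ) ^ p) using 1
  have hsign : (-1 : ℤ) ^ ((p + 1) * (q + 1)) = -((-1) ^ p * (-1) ^ ((p + 1) * q)) := by ring
  rw [add_sub_sub_cancel, smul_add, smul_smul, smul_smul, neg_one_pow_mul_self, one_smul, hsign,
    neg_smul, sub_neg_eq_add]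

theorem torsionCohomology_zero_eq_zero (t : TorsionCohomology X 0) : t = 0 := by
  obtain ⟨t, ht⟩ := t
  obtain ⟨z, rfl⟩ := cohomologyClass_surjective t
  obtain ⟨N, hN, hNz⟩ := exists_nsmul_mem_coboundaries z ht
  have nsmul_eq_zero : N • (z : Cochain X ℤ 0) = 0 := hNz
  refine Subtype.ext ((cohomologyClass_eq_zero (f := z)).mpr ?_)
  rw [(smul_eq_zero.mp nsmul_eq_zero).resolve_left hN.ne']
  exact zero_mem _

theorem exists_isBockstein_eq {p : ℕ} (t : TorsionCohomology X (p + 1)) :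
    ∃ (f : cocycles X UnitAddCircle p) (z : cocycles X ℤ (p + 1)),
      IsBockstein (f : Cochain X UnitAddCircle p) (z : Cochain X ℤ (p + 1)) ∧
        cohomologyClass z = (t : Cohomology X ℤ (p + 1)) := by
  obtain ⟨u, hu⟩ := exists_bockstein_eq t
  obtain ⟨f, rfl⟩ := cohomologyClass_surjective u
  obtain ⟨z, hz⟩ := exists_isBockstein f
  exact ⟨f, ⟨z, hz.mem_cocycles⟩, hz, by rw [← hu, bockstein_class f ⟨z, hz.mem_cocycles⟩ hz]⟩

theorem torsionPairing_class {n : ℕ} (c : Homology X n) {p q : ℕ} (h : p + 1 + q = n + 1)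
    {f : cocycles X UnitAddCircle p} {z : cocycles X ℤ (p + 1)}
    (hfz : IsBockstein (f : Cochain X UnitAddCircle p) (z : Cochain X ℤ (p + 1)))
    {t : TorsionCohomology X (p + 1)} (ht : cohomologyClass z = (t : Cohomology X ℤ (p + 1)))
    {z' : cocycles X ℤ q} {t' : TorsionCohomology X q}
    (ht' : cohomologyClass z' = (t' : Cohomology X ℤ q)) :
    torsionPairing c (p + 1) q h t t' =
      cohomologyEval (cocycleCup (by omega : p + q = n) f z') c := by
  change cohomologyEval (linkingClass (by omega : p + q = n) t t') c = _
  rw [linkingClass_eq _ t t' (cohomologyClass f) ((bockstein_class f z hfz).trans ht), ← ht',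
    cup_class]

theorem torsionPairing_symm {n : ℕ} (c : Homology X n) (k l : ℕ) (h : k + l = n + 1)
    (h' : l + k = n + 1) (t : TorsionCohomology X k) (t' : TorsionCohomology X l) :
    torsionPairing c k l h t t' = (-1 : ℤ) ^ (k * l) • torsionPairing c l k h' t' t := by
  rcases k with - | p
  · rw [torsionCohomology_zero_eq_zero t, map_zero, map_zero, AddMonoidHom.zero_apply, smul_zero]
  rcases l with - | q
  · rw [torsionCohomology_zero_eq_zero t', map_zero, map_zero, AddMonoidHom.zero_apply, smul_zero]
  obtain rfl : n = p + q + 1 := by omega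
  obtain ⟨f, z, hfz, hz⟩ := exists_isBockstein_eq t
  obtain ⟨f', z', hfz', hz'⟩ := exists_isBockstein_eq t'
  rw [torsionPairing_class c h hfz hz hz', torsionPairing_class c h' hfz' hz' hz,
    cocycleCup_apply, cocycleCup_apply, ← AddMonoidHom.smul_apply, ← map_zsmul, ← map_zsmul]
  refine DFunLike.congr_fun (congrArg _ ?_) c
  rw [← sub_eq_zero, ← map_sub, cohomologyClass_eq_zero]
  exact hfz.cochainCup_sub_mem_coboundaries hfz' f'.2

theorem torsionPairing_neg_one_pow_smul_left {n : ℕ} (c : Homology X n) (k l : ℕ)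
    (h : k + l = n + 1) (h' : l + k = n + 1) (t : TorsionCohomology X k)
    (t' : TorsionCohomology X l) :
    torsionPairing c k l h ((-1 : ℤ) ^ (k * l + 1) • t) t' =
      -torsionPairing c l k h' t' t := by
  rw [map_zsmul, AddMonoidHom.smul_apply, torsionPairing_symm c k l h h', smul_smul, pow_succ,
    mul_neg_one, neg_mul, neg_one_pow_mul_self, neg_smul, one_smul]

theorem sigmaTorSurface_zetaTor {n : ℕ} (c : Homology X n) (k l : ℕ) (h : k + l = n + 1)
    (h' : l + k = n + 1) (x y : TopTor X k l) :
    (sigmaTorSurface c l k h').toHom (zetaTor X k l x) (zetaTor X k l y) =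
      (sigmaTorSurface c k l h).toHom x y := by
  rw [sigmaTorSurface_apply, sigmaTorSurface_apply]
  change torsionPairing c k l _ ((-1 : ℤ) ^ (k * l + 1) • x.1) y.2 -
    torsionPairing c k l _ ((-1 : ℤ) ^ (k * l + 1) • y.1) x.2 = _
  rw [torsionPairing_neg_one_pow_smul_left c k l h h',
    torsionPairing_neg_one_pow_smul_left c k l h h', sub_neg_eq_add, neg_add_eq_sub]

theorem zetaTor_injective (k l : ℕ) : Function.Injective (zetaTor X k l) := by
  rintro ⟨t, t'⟩ ⟨s, s'⟩ heq
  have hfst : t' = s' := congrArg Prod.fst heq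
  have hsnd : (-1 : ℤ) ^ (k * l + 1) • t = (-1 : ℤ) ^ (k * l + 1) • s := congrArg Prod.snd heq
  have hsign := congrArg ((-1 : ℤ) ^ (k * l + 1) • ·) hsnd
  simp only [smul_smul, neg_one_pow_mul_self, one_smul] at hsign
  rw [hsign, hfst]

theorem isAddTorsion_topTor (k l : ℕ) : IsAddTorsion (TopTor X k l) :=
  fun x => (AddSubmonoid.isOfFinAddOrder_coe.mp x.1.2).prod_mk
    (AddSubmonoid.isOfFinAddOrder_coe.mp x.2.2)

variable {S : Type v} [TopologicalSpace S] (i : C(S, X)) {n : ℕ} (c : Homology S n) (k l : ℕ)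

/-- The form `σ_tor` on `H^{k,l}_tor(X; ℤ)` defined by pulling back along `i : S → X` and
evaluating on the homology class `c` of `S`. The form of a spacetime is the case of the inclusion
and fundamental class of a Cauchy surface. -/
def sigmaTorAlong (h : k + l = n + 1) : PresymplecticForm (TopTor X k l) :=
  (sigmaTorSurface c k l h).pullback (TopTor.pullback i k l)

theorem isAlternating_sigmaTorAlong (h : k + l = n + 1) :
    (sigmaTorAlong i c k l h).IsAlternating :=
  fun _ => sub_self _

theorem pullback_zetaTor (x : TopTor X k l) :
    TopTor.pullback i l k (zetaTor X k l x) = zetaTor S k l (TopTor.pullback i k l x) :=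
  Prod.ext rfl (map_zsmul (TorsionCohomology.pullback i k) _ _)

theorem sigmaTorAlong_zetaTor (h : k + l = n + 1) (h' : l + k = n + 1) (x y : TopTor X k l) :
    (sigmaTorAlong i c l k h').toHom (zetaTor X k l x) (zetaTor X k l y) =
      (sigmaTorAlong i c k l h).toHom x y := by
  change (sigmaTorSurface c l k h').toHom (TopTor.pullback i l k (zetaTor X k l x))
    (TopTor.pullback i l k (zetaTor X k l y)) = _
  rw [pullback_zetaTor, pullback_zetaTor, sigmaTorSurface_zetaTor c k l h h']
  rfl

end Duality

end AbelianDuality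

end

open AbelianDuality in
theorem mainTheorem8_general {X : Type*} [TopologicalSpace X] {S : Type*} [TopologicalSpace S]
    (i : C(S, X)) {n : ℕ} (c : Homology S n) {k l : ℕ} (h : k + l = n + 1) (h' : l + k = n + 1) :
    (∃! φ : WeylAlgebra (sigmaTorAlong i c k l h) →L[ℂ] ℂ, IsCanonicalTrace φ) ∧
    (∃! Z : WeylAlgebra (sigmaTorAlong i c k l h) →⋆ₐ[ℂ] WeylAlgebra (sigmaTorAlong i c l k h'),
      ∀ x, Z (weyl _ x) = weyl _ (zetaTor X k l x)) ∧
    (∀ φ : WeylAlgebra (sigmaTorAlong i c k l h) →L[ℂ] ℂ, IsCanonicalTrace φ →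
      IsState φ ∧ IsFaithful φ) ∧
    (∀ (φ : WeylAlgebra (sigmaTorAlong i c k l h) →L[ℂ] ℂ)
      (ψ : WeylAlgebra (sigmaTorAlong i c l k h') →L[ℂ] ℂ)
      (Z : WeylAlgebra (sigmaTorAlong i c k l h) →⋆ₐ[ℂ] WeylAlgebra (sigmaTorAlong i c l k h')),
      IsCanonicalTrace φ → IsCanonicalTrace ψ →
        (∀ x, Z (weyl _ x) = weyl _ (zetaTor X k l x)) → ∀ a, ψ (Z a) = φ a) := by
  have alternating := isAlternating_sigmaTorAlong i c k l h
  refine ⟨existsUnique_isCanonicalTrace alternating,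
    ((isWeylSystem_weyl _).comp (sigmaTorAlong_zetaTor i c k l h h')).existsUnique_hom,
    fun φ hφ => ⟨hφ.isState alternating, hφ.isFaithful (isAddTorsion_topTor k l) alternating⟩,
    fun φ ψ Z hφ hψ hZ a => ?_⟩
  have invariant : ψ.comp (weylHomL Z) = φ := (hψ.comp (zetaTor_injective k l) hZ).eq hφ
  exact DFunLike.congr_fun invariant a

open scoped Manifold ContDiff in
theorem mainTheorem8 (n : ℕ)
    (M : Type*) [TopologicalSpace M] [T2Space M] [SecondCountableTopology M] [ConnectedSpace M]
    [ChartedSpace (EuclideanSpace ℝ (Fin (n + 1))) M] [IsManifold (𝓡 (n + 1)) ∞ M]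
    (S : Type*) [TopologicalSpace S] [CompactSpace S]
    [ChartedSpace (EuclideanSpace ℝ (Fin n)) S] [IsManifold (𝓡 n) ∞ S]
    (D : AbelianDuality.CauchySpacetime n M S)
    (k l : ℕ) (h : k + l = n + 1) (h' : l + k = n + 1) :
    (∃! φ : D.TorWeylAlgebra k l h →L[ℂ] ℂ, D.IsTorFunctional φ) ∧
    (∃! Z : D.TorWeylAlgebra k l h →⋆ₐ[ℂ] D.TorWeylAlgebra l k h', D.IsTorDuality Z) ∧
    (∀ φ : D.TorWeylAlgebra k l h →L[ℂ] ℂ, D.IsTorFunctional φ →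
      AbelianDuality.IsState φ ∧ AbelianDuality.IsFaithful φ) ∧
    (∀ (φ : D.TorWeylAlgebra k l h →L[ℂ] ℂ) (ψ : D.TorWeylAlgebra l k h' →L[ℂ] ℂ)
      (Z : D.TorWeylAlgebra k l h →⋆ₐ[ℂ] D.TorWeylAlgebra l k h'),
      D.IsTorFunctional φ → D.IsTorFunctional ψ → D.IsTorDuality Z →
        ∀ a, ψ (Z a) = φ a) :=
  mainTheorem8_general D.incl D.fundamentalClass h h'
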